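/- Let $s,n\in\mathbb N$ with $n\ge 1$, let $U_s=[-\frac12,\frac12]^s$, let $Z$ be a separable (real) Banach space, and let $\gamma_{\mathfrak u}>0$ be weights for $\mathfrak u\subseteq\{1,\dots,s\}$. For $\boldsymbol z\in\mathbb N^s$ and $\boldsymbol\Delta\in[0,1]^s$ the shifted lattice rule uses the points $$\boldsymbol y^{(i)}_{\boldsymbol\Delta}=\mathrm{frac}\Big(\frac{i\boldsymbol z}{n}+\boldsymbol\Delta\Big)-\Big(\tfrac12,\dots,\tfrac12\Big),\qquad i=1,\dots,n,$$ with the fractional part taken componentwise. The component-by-component (CBC) construction with weights $(\gamma_{\mathfrak u})$ chooses successively, for $d=1,\dots,s$ and with $z_1,\dots,z_{d-1}$ kept fixed, a $z_d\in\{w\in\mathbb N:1\le w\le n,\ \gcd(w,n)=1\}$ that minimizes $$\sum_{\emptyset\ne\mathfrak u\subseteq\{1,\dots,d\}}\gamma_{\mathfrak u}\,\frac1n\sum_{k=0}^{n-1}\prod_{j\in\mathfrak u}B_2\Big(\mathrm{frac}\Big(\frac{kz_j}{n}\Big)\Big),\qquad B_2(x)=x^2-x+\tfrac16,$$ which is the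 shift-averaged squared worst-case error of the $d$-dimensional rule in the unanchored weighted Sobolev space with these weights. Let $g:U_s\to Z$ be continuous, and suppose that all mixed first-order partial derivatives $\partial^{|\mathfrak u|}g/\partial\boldsymbol y_{\mathfrak u}$, $\mathfrak u\subseteq\{1,\dots,s\}$, exist on $U_s$ (one-sided on the boundary, and independent of the order of differentiation). Suppose that there are constants $C_0>0$, $r_1\ge0$, $r_2>0$ and positive numbers $\rho_1,\dots,\rho_s$ such that $$\Big\|\frac{\partial^{|\mathfrak u|}}{\partial\boldsymbol y_{\mathfrak u}}g(\boldsymbol y)\Big\|_Z\le C_0\,(|\mathfrak u|+r_1)!\prod_{j\in\mathfrak u}(r_2\,\rho_j)\qquad\text{for all }\mathfrak u\subseteq\{1,\dots,s\},\ \boldsymbol y\in U_s,$$ where $x!=\Gamma(x+1)$. Then $g$ is Bochner integrable, the CBC construction has an output, and every output $\boldsymbol z$ of it (however ties are broken) satisfies, for $\boldsymbol\Delta$ uniformly distributed on $[0,1]^s$ and for all $\lambda\in(\frac12,1]$, $$\mathbb E_{\boldsymbol\Delta}\Big\|\int_{U_s}g(\boldsymbol y)\,\mathrm d\boldsymbol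 y-\frac1n\sum_{i=1}^n g\big(\boldsymbol y^{(i)}_{\boldsymbol\Delta}\big)\Big\|_Z^2\le C_{s,\boldsymbol\gamma,\lambda}\,[\phi_{\rm tot}(n)]^{-1/\lambda},$$ the squared error being integrable in $\boldsymbol\Delta$. Here $\phi_{\rm tot}$ is the Euler totient function, with $1/\phi_{\rm tot}(n)\le 2/n$ when $n$ is a prime power, and, with $\zeta$ the Riemann zeta function, $$C_{s,\boldsymbol\gamma,\lambda}=C_0^2\bigg(\sum_{\emptyset\ne\mathfrak u\subseteq\{1,\dots,s\}}\gamma_{\mathfrak u}^{\lambda}\Big(\frac{2\zeta(2\lambda)}{(2\pi^2)^{\lambda}}\Big)^{|\mathfrak u|}\bigg)^{1/\lambda}\bigg(\sum_{\mathfrak u\subseteq\{1,\dots,s\}}\frac{[(|\mathfrak u|+r_1)!]^2\prod_{j\in\mathfrak u}(r_2\,\rho_j)^2}{\gamma_{\mathfrak u}}\bigg).$$ -/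

import Mathlib

open MeasureTheory

noncomputable section

namespace RandomLattice

/-- The cube `U_s = [-1/2, 1/2]^s`. -/
def cube (s : ℕ) : Set (Fin s → ℝ) := Set.Icc (fun _ => -(1 / 2)) (fun _ => 1 / 2)

/-- `D u` is the mixed first-order partial derivative `∂^{|u|} g / ∂y_u` on the cube, for every set
`u` of coordinates: `D ∅ = g`, and differentiating `D u` once more in a coordinate `j ∉ u`
(one-sidedly on the boundary of the cube) gives `D (u ∪ {j})`. -/
def HasMixedDerivs {s : ℕ} {Z : Type*} [NormedAddCommGroup Z] [NormedSpace ℝ Z]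
    (g : (Fin s → ℝ) → Z) (D : Finset (Fin s) → (Fin s → ℝ) → Z) : Prop :=
  (∀ y ∈ cube s, D ∅ y = g y) ∧
  ∀ (u : Finset (Fin s)) (j : Fin s), j ∉ u → ∀ y ∈ cube s,
    HasDerivWithinAt (fun t : ℝ => D u (Function.update y j t)) (D (insert j u) y)
      (Set.Icc (-(1 / 2)) (1 / 2)) (y j)

/-- The `i`-th point `frac (i z / n + Δ) - (1/2, …, 1/2)` of the lattice rule with generating
vector `z` and shift `Δ`. -/
def latticePoint {s : ℕ} (n : ℕ) (z : Fin s → ℕ) (Δ : Fin s → ℝ) (i : ℕ) : Fin s → ℝ :=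
  fun j => Int.fract ((i : ℝ) * (z j : ℝ) / (n : ℝ) + Δ j) - 1 / 2

/-- The shifted lattice rule `(1/n) ∑_{i=1}^n g(y^{(i)}_Δ)`. -/
def latticeRule {s : ℕ} {Z : Type*} [NormedAddCommGroup Z] [NormedSpace ℝ Z]
    (n : ℕ) (z : Fin s → ℕ) (Δ : Fin s → ℝ) (g : (Fin s → ℝ) → Z) : Z :=
  (1 / (n : ℝ)) • ∑ i ∈ Finset.Icc 1 n, g (latticePoint n z Δ i)

/-- The squared error of the shifted lattice rule in the norm of `Z`. -/
def sqError {s : ℕ} {Z : Type*} [NormedAddCommGroup Z] [NormedSpace ℝ Z]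
    (n : ℕ) (z : Fin s → ℕ) (g : (Fin s → ℝ) → Z) (Δ : Fin s → ℝ) : ℝ :=
  ‖(∫ y in cube s, g y) - latticeRule n z Δ g‖ ^ 2

/-- The candidates for a component of the generating vector: the integers between `1` and `n` that
are coprime to `n` (for `n ≥ 2` these lie between `1` and `n - 1`). -/
def candidates (n : ℕ) : Finset ℕ := {w ∈ Finset.Icc 1 n | Nat.Coprime w n}

/-- The shift-averaged squared worst-case error, in the unanchored weighted Sobolev space with
weights `γ`, of the lattice rule that uses the components of `z` up to and including `d`,
`∑_{∅ ≠ u ⊆ {j ≤ d}} γ_u (1/n) ∑_{k=0}^{n-1} ∏_{j ∈ u} B₂(frac (k z_j / n))`,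
in the form in which a component-by-component algorithm evaluates it. -/
def shiftAvgError {s : ℕ} (n : ℕ) (γ : Finset (Fin s) → ℝ) (d : Fin s) (z : Fin s → ℕ) : ℝ :=
  ∑ u ∈ (Finset.Iic d).powerset with u.Nonempty,
    γ u * ((1 / (n : ℝ)) * ∑ k ∈ Finset.range n,
      ∏ j ∈ u, bernoulliFun 2 (Int.fract ((k : ℝ) * (z j : ℝ) / (n : ℝ))))

/-- `z` is an output of the component-by-component construction with `n` points and weights `γ`:
successively for each `d`, with the earlier components kept fixed, the component `z d` is a
candidate that minimizes the shift-averaged squared worst-case error in the first coordinates up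
to `d`. Ties may be broken in any way. -/
def IsCBC {s : ℕ} (n : ℕ) (γ : Finset (Fin s) → ℝ) (z : Fin s → ℕ) : Prop :=
  ∀ d : Fin s, z d ∈ candidates n ∧
    ∀ w ∈ candidates n, shiftAvgError n γ d z ≤ shiftAvgError n γ d (Function.update z d w)

/-- `x ! = Γ(x + 1)`, the usual factorial at natural numbers. -/
def realFactorial (x : ℝ) : ℝ := Real.Gamma (x + 1)

/-- The constant `C_{s,γ,λ}`. -/
def errorConst {s : ℕ} (γ : Finset (Fin s) → ℝ) (C₀ r₁ r₂ : ℝ) (ρ : Fin s → ℝ) (lam : ℝ) : ℝ :=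
  C₀ ^ 2 *
    (∑ u : Finset (Fin s) with u.Nonempty,
      γ u ^ lam *
        (2 * (riemannZeta ((2 * lam : ℝ) : ℂ)).re / (2 * Real.pi ^ 2) ^ lam) ^ u.card) ^ (1 / lam) *
    ∑ u : Finset (Fin s),
      realFactorial (u.card + r₁) ^ 2 * (∏ j ∈ u, (r₂ * ρ j) ^ 2) / γ u

end RandomLattice

end

/-!
The error of the shifted lattice rule is expanded in mixed derivatives of `g`, which works directly
in the Banach space. In one variable, `f y = ∫ f + ∫ k(y, t) f'(t) dt` on `[-1/2, 1/2]`, with the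
Peano kernel `k(y, t) = t + 1/2` for `t ≤ y` and `t - 1/2` for `t > y`. Applying this coordinate by
coordinate (`eq_sum_integral_peanoKernel`) gives
`Q g - ∫ g = ∑_{u ≠ ∅} ∫ h_u(t) ∂^{|u|} g / ∂y_u (t) dt`, where `h_u` is the mean over the points of
the rule of products of Peano kernels (`latticeRule_sub_integral`). By Cauchy–Schwarz the squared
error is at most `∑_u B_u² / γ_u` times `∑_{u ≠ ∅} γ_u ∫ h_u²`, where `B_u` bounds the derivative
(`sqError_le`).

The second factor depends only on the rule and the shift. Averaged over the shift, each one-variable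
integral `∫ k(x, t) k(y, t) dt` becomes `B₂ (frac (x - y))` (`integral_peanoGram_fract`), so that
the factor turns into the quantity minimized by the component-by-component construction
(`integral_integral_latticeKernel_sq`).

That quantity is bounded through discrete Fourier analysis on `ZMod n`. The coefficients
`1 / (2 π² h²)` of `B₂` are nonnegative, and so are those of products (`exists_fourier_coeffs`);
their `λ`-th powers are summable for `λ > 1/2`. The component chosen in a step is no worse than the
mean over all candidates, and since `x ↦ x ^ λ` is subadditive, it suffices to sum `λ`-th powers of
coefficients over the frequencies orthogonal to the generating vector. For a fixed frequency `h` in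
the new coordinate, the congruence `h w ≡ x` modulo `n` has at most `g = gcd (x, n)` solutions `w`
coprime to `n`, and none unless `g ∣ h` (`solutionCount_le`); the factor `g` is compensated by
`|h|^(-2λ) ≤ g⁻¹ |h / g|^(-2λ)` (`tsum_solutionCount_mul_le`). Induction over the coordinates
completes the bound (`sum_latticeMean_le_of_isCBC`).
-/

namespace RandomLattice

/-! ### Subadditivity of concave powers -/

theorem rpow_sum_le_sum_rpow {ι : Type*} (s : Finset ι) {f : ι → ℝ} (hf : ∀ i, 0 ≤ f i) {p : ℝ}
    (hp : 0 < p) (hp1 : p ≤ 1) : (∑ i ∈ s, f i) ^ p ≤ ∑ i ∈ s, f i ^ p := by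
  classical
  induction s using Finset.induction_on with
  | empty => simp [Real.zero_rpow hp.ne']
  | insert a s ha ih =>
    rw [Finset.sum_insert ha, Finset.sum_insert ha]
    exact (Real.rpow_add_le_add_rpow (hf a) (Finset.sum_nonneg fun i _ => hf i) hp.le hp1).trans
      (by gcongr)

theorem rpow_tsum_le_tsum_rpow {ι : Type*} {f : ι → ℝ} (hf : ∀ i, 0 ≤ f i) {p : ℝ}
    (hp : 0 < p) (hp1 : p ≤ 1) (hs : Summable f) (hsp : Summable fun i => f i ^ p) :
    (∑' i, f i) ^ p ≤ ∑' i, f i ^ p := by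
  have hlim := hs.hasSum.rpow_const (Or.inr hp.le : _ ∨ 0 ≤ p)
  refine le_of_tendsto hlim (Filter.Eventually.of_forall fun s => ?_)
  exact (rpow_sum_le_sum_rpow s hf hp hp1).trans
    (hsp.sum_le_tsum s fun i _ => Real.rpow_nonneg (hf i) p)

/-! ### Fourier coefficients of the second Bernoulli polynomial -/

/-- The Fourier coefficient `1 / (2 π² h²)` of the periodized second Bernoulli polynomial at the
frequency `h`; at `h = 0` the convention `0⁻¹ = 0` gives the correct value `0`. -/
noncomputable def bernoulliMass (h : ℤ) : ℝ := (2 * Real.pi ^ 2)⁻¹ * ((h : ℝ) ^ 2)⁻¹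

theorem bernoulliMass_nonneg (h : ℤ) : 0 ≤ bernoulliMass h := by
  unfold bernoulliMass; positivity

theorem bernoulliMass_mul (g h : ℤ) :
    bernoulliMass (g * h) = ((g : ℝ) ^ 2)⁻¹ * bernoulliMass h := by
  simp only [bernoulliMass, Int.cast_mul, mul_pow, mul_inv]; ring

theorem bernoulliMass_rpow (h : ℤ) (p : ℝ) :
    bernoulliMass h ^ p = ((2 * Real.pi ^ 2) ^ p)⁻¹ * |(h : ℝ)| ^ (-(2 * p)) := by
  unfold bernoulliMass
  rw [Real.mul_rpow (by positivity) (by positivity), Real.inv_rpow (by positivity),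
    Real.inv_rpow (by positivity), ← sq_abs (h : ℝ), Real.rpow_neg (abs_nonneg _),
    Real.rpow_mul (abs_nonneg _), Real.rpow_two]

theorem summable_bernoulliMass_rpow {p : ℝ} (hp : 1 / 2 < p) :
    Summable fun h => bernoulliMass h ^ p := by
  simp_rw [bernoulliMass_rpow]
  exact (Real.summable_abs_int_rpow (by linarith)).mul_left _

theorem summable_bernoulliMass : Summable bernoulliMass := by
  simpa using summable_bernoulliMass_rpow (p := 1) (by norm_num)

theorem tsum_bernoulliMass_rpow {p : ℝ} (hp : 1 / 2 < p) :
    ∑' h, bernoulliMass h ^ p =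
      2 * (riemannZeta ((2 * p : ℝ) : ℂ)).re / (2 * Real.pi ^ 2) ^ p := by
  have hp2 : 1 < 2 * p := by linarith
  have hz : (riemannZeta ((2 * p : ℝ) : ℂ)).re = ∑' n : ℕ+, (n : ℝ) ^ (-(2 * p)) := by
    rw [zeta_eq_tsum_one_div_nat_cpow (by simpa using hp2)]
    have : (∑' n : ℕ, 1 / (n : ℂ) ^ ((2 * p : ℝ) : ℂ))
        = ((∑' n : ℕ, (n : ℝ) ^ (-(2 * p)) : ℝ) : ℂ) := by
      rw [Complex.ofReal_tsum]
      refine tsum_congr fun n => ?_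
      rw [Real.rpow_neg (Nat.cast_nonneg n), Complex.ofReal_inv,
        Complex.ofReal_cpow (Nat.cast_nonneg n), one_div, Complex.ofReal_natCast]
    rw [this, Complex.ofReal_re, (Real.summable_nat_rpow.2 (by linarith)).tsum_eq_zero_add,
      ← tsum_pnat_eq_tsum_succ (f := fun n : ℕ => (n : ℝ) ^ (-(2 * p)))]
    simp [Real.zero_rpow (show -(2 * p) ≠ 0 by linarith)]
  simp_rw [bernoulliMass_rpow]
  rw [tsum_mul_left, tsum_int_eq_zero_add_two_mul_tsum_pnat, hz]
  · simp [Real.zero_rpow (show -(2 * p) ≠ 0 by linarith)]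
    ring
  · intro n; simp
  · exact Real.summable_abs_int_rpow (by linarith)

/-- The Fourier series of the second Bernoulli polynomial at a rational point, written with the
standard additive character of `ZMod n`. -/
theorem hasSum_bernoulliMass_mul_stdAddChar {n : ℕ} [NeZero n] (k : ℤ) :
    HasSum (fun h : ℤ => (bernoulliMass h : ℂ) * ZMod.stdAddChar ((h : ZMod n) * (k : ZMod n)))
      (bernoulliFun 2 (Int.fract ((k : ℝ) / n)) : ℂ) := by
  have h := (hasSum_one_div_pow_mul_fourier_mul_bernoulliFun le_rfl
    (x := Int.fract ((k : ℝ) / n)) ⟨Int.fract_nonneg _, (Int.fract_lt_one _).le⟩).mul_left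
    (((2 * Real.pi ^ 2 : ℝ) : ℂ)⁻¹)
  have hpi : (Real.pi : ℂ) ≠ 0 := by exact_mod_cast Real.pi_ne_zero
  convert! h using 1
  · funext m
    have hx : ((Int.fract ((k : ℝ) / n) : ℝ) : UnitAddCircle) =
        (((k : ℝ) / n : ℝ) : UnitAddCircle) :=
      AddCircle.coe_fract _
    rw [hx, fourier_coe_apply, ← Int.cast_mul, ZMod.stdAddChar_coe]
    unfold bernoulliMass
    push_cast
    rw [mul_assoc]
    congr 1
    rw [one_div]
    congr 2
    field_simp
  · norm_num [mul_pow]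
    field_simp
    norm_num

/-- The total Fourier mass of the frequencies in the residue class `m` modulo `n`: the `m`-th
discrete Fourier coefficient of `k ↦ B₂ (frac (k / n))`. -/
noncomputable def residueMass (n : ℕ) (m : ZMod n) : ℝ :=
  ∑' h : ℤ, if (h : ZMod n) = m then bernoulliMass h else 0

theorem residueMass_nonneg (n : ℕ) (m : ZMod n) : 0 ≤ residueMass n m :=
  tsum_nonneg fun h => by split_ifs <;> simp [bernoulliMass_nonneg]

theorem summable_ite {R : Type*} [NormedAddCommGroup R] [CompleteSpace R] {f : ℤ → R}
    (hf : Summable fun h => ‖f h‖) (P : ℤ → Prop) [DecidablePred P] :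
    Summable fun h => if P h then f h else 0 :=
  hf.of_norm_bounded fun h => by split_ifs <;> simp

/-- Summation over all integers, sorted by residue classes. -/
theorem sum_mul_tsum_residue {R : Type*} [NormedCommRing R] [CompleteSpace R] {n : ℕ} [NeZero n]
    {f : ℤ → R} (hf : Summable fun h => ‖f h‖) (F : ZMod n → R) :
    ∑ m, F m * ∑' h : ℤ, (if (h : ZMod n) = m then f h else 0) =
      ∑' h : ℤ, F (h : ZMod n) * f h := by
  have h1 : ∀ m, F m * ∑' h : ℤ, (if (h : ZMod n) = m then f h else 0) =
      ∑' h : ℤ, F m * (if (h : ZMod n) = m then f h else 0) := fun m =>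
    ((summable_ite hf _).tsum_mul_left _).symm
  simp_rw [h1]
  rw [← Summable.tsum_finsetSum fun m _ => (summable_ite hf _).mul_left _]
  refine tsum_congr fun h => ?_
  simp

theorem bernoulliFun_two_eq_sum_residueMass {n : ℕ} [NeZero n] (k : ℤ) :
    (bernoulliFun 2 (Int.fract ((k : ℝ) / n)) : ℂ) =
      ∑ m : ZMod n, (residueMass n m : ℂ) * ZMod.stdAddChar (m * (k : ZMod n)) := by
  rw [← (hasSum_bernoulliMass_mul_stdAddChar (n := n) k).tsum_eq]
  have := sum_mul_tsum_residue (n := n) (f := fun h => (bernoulliMass h : ℂ))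
    (by simpa using summable_bernoulliMass.abs)
    (fun m => ZMod.stdAddChar (m * (k : ZMod n)))
  simp_rw [mul_comm (bernoulliMass _ : ℂ)]
  rw [← this]
  refine Finset.sum_congr rfl fun m _ => ?_
  rw [mul_comm, residueMass, Complex.ofReal_tsum]
  congr 1
  refine tsum_congr fun h => ?_
  split_ifs <;> simp

theorem residueMass_rpow_le {n : ℕ} (m : ZMod n) {p : ℝ} (hp : 1 / 2 < p) (hp1 : p ≤ 1) :
    residueMass n m ^ p ≤ ∑' h : ℤ, if (h : ZMod n) = m then bernoulliMass h ^ p else 0 := by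
  have hp0 : 0 < p := by linarith
  have e : ∀ h : ℤ, (if (h : ZMod n) = m then bernoulliMass h else 0) ^ p =
      if (h : ZMod n) = m then bernoulliMass h ^ p else 0 := fun h => by
    split_ifs <;> simp [Real.zero_rpow hp0.ne']
  simp_rw [← e]
  refine rpow_tsum_le_tsum_rpow (fun h => ?_) hp0 hp1
    (summable_ite summable_bernoulliMass.norm _) ?_
  · split_ifs <;> simp [bernoulliMass_nonneg]
  · simp_rw [e]
    exact summable_ite (summable_bernoulliMass_rpow hp).norm _

theorem sum_mul_residueMass_rpow_le {n : ℕ} [NeZero n] {F : ZMod n → ℝ} (hF : ∀ m, 0 ≤ F m)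
    {p : ℝ} (hp : 1 / 2 < p) (hp1 : p ≤ 1) :
    ∑ m, F m * residueMass n m ^ p ≤ ∑' h : ℤ, F (h : ZMod n) * bernoulliMass h ^ p := by
  rw [← sum_mul_tsum_residue (summable_bernoulliMass_rpow hp).norm F]
  gcongr with m _
  · exact hF m
  · exact residueMass_rpow_le m hp hp1

/-! ### Averaging over the candidates -/

/-- The number of candidates `w` with `h * w = x` in `ZMod n`. -/
def solutionCount (n : ℕ) (x h : ZMod n) : ℕ :=
  Finset.card {w ∈ candidates n | h * Nat.cast w = x}

/-- The congruence `h * w = x` has a solution `w` coprime to `n` only if `h` and `x` have the same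
greatest common divisor `g` with `n`, and then its solutions agree modulo `n / g`. -/
theorem solutionCount_le {n : ℕ} [NeZero n] (x : ZMod n) (h : ℤ) :
    solutionCount n x h ≤ if (x.val.gcd n : ℤ) ∣ h then x.val.gcd n else 0 := by
  have hn : 0 < n := Nat.pos_of_ne_zero (NeZero.ne n)
  rcases Finset.eq_empty_or_nonempty {w ∈ candidates n | (h : ZMod n) * Nat.cast w = x} with
    he | ⟨v, hv⟩
  · simp [solutionCount, he]
  have key : ∀ w : ℕ, (h : ZMod n) * (w : ZMod n) = x → h * w ≡ x.val [ZMOD n] := fun w hw => by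
    rw [← ZMod.intCast_eq_intCast_iff]
    simpa using hw
  simp only [candidates, Finset.mem_filter] at hv
  have hg : x.val.gcd n = Int.gcd h n := by
    have h1 : Int.gcd (h * v) n = Int.gcd x.val n := by
      rw [← Int.gcd_emod, key v hv.2, Int.gcd_emod]
    have hc : Int.gcd (v : ℤ) n = 1 := by simpa using hv.1.2
    rw [Int.gcd_natCast_natCast] at h1
    rw [← h1, mul_comm, Int.gcd_mul_right_left_of_gcd_eq_one hc]
  have hgpos : 0 < Int.gcd h n := Int.gcd_pos_of_ne_zero_right _ (by exact_mod_cast hn.ne')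
  have hgn : Int.gcd h n ∣ n := by exact_mod_cast Int.gcd_dvd_right h n
  rw [hg, if_pos (Int.gcd_dvd_left h n)]
  obtain ⟨m, hm⟩ := hgn
  have hmpos : 0 < m := Nat.pos_of_ne_zero fun h0 => by simp [h0] at hm; omega
  have hmod : ∀ w ∈ ({w ∈ candidates n | (h : ZMod n) * Nat.cast w = x} : Finset ℕ),
      w ≡ v [MOD m] := fun w hw => by
    have h1 := (key w (Finset.mem_filter.1 hw).2).trans (key v hv.2).symm
    have h2 := h1.cancel_left_div_gcd (by exact_mod_cast hn)
    have h3 : (n : ℤ) / (Int.gcd n h) = m := by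
      rw [Int.gcd_comm]
      nth_rw 1 [hm]
      push_cast
      exact Int.mul_ediv_cancel_left _ (by exact_mod_cast hgpos.ne')
    rw [h3] at h2
    exact Int.natCast_modEq_iff.1 h2
  -- With `n = g m`, a solution in `[1, n]` is determined by the block of length `m` containing it.
  have := Finset.card_le_card_of_injOn (t := Finset.range (Int.gcd h n))
    (s := {w ∈ candidates n | (h : ZMod n) * Nat.cast w = x}) (fun w => (w - 1) / m) ?_ ?_
  · simpa [solutionCount] using this
  · intro w hw
    simp only [candidates, Finset.coe_filter, Finset.mem_filter, Finset.mem_Icc,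
      Set.mem_ofPred_eq] at hw
    simp only [Finset.coe_range, Set.mem_Iio]
    rw [Nat.div_lt_iff_lt_mul hmpos, ← hm]
    omega
  · intro w hw w' hw' heq
    have hww := (hmod w hw).trans (hmod w' hw').symm
    simp only [candidates, Finset.coe_filter, Finset.mem_filter, Finset.mem_Icc,
      Set.mem_ofPred_eq] at hw hw'
    have h1 : w - 1 ≡ w' - 1 [MOD m] := by
      apply Nat.ModEq.add_right_cancel' 1
      rwa [Nat.sub_add_cancel hw.1.1.1, Nat.sub_add_cancel hw'.1.1.1]
    have h2 : (w - 1) / m = (w' - 1) / m := heq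
    have e1 := Nat.div_add_mod (w - 1) m
    have e2 := Nat.div_add_mod (w' - 1) m
    have h3 : (w - 1) % m = (w' - 1) % m := h1
    rw [h2, h3] at e1
    omega

/-- Among the frequencies `h` that are multiples of `g`, the factor `g` lost by counting solutions
is made up for by `|g h|^(-2p) = g^(-2p) |h|^(-2p)`, because `2p > 1`. -/
theorem tsum_solutionCount_mul_le {n : ℕ} [NeZero n] (x : ZMod n) {p : ℝ} (hp : 1 / 2 < p) :
    ∑' h : ℤ, (solutionCount n x h : ℝ) * bernoulliMass h ^ p ≤ ∑' h, bernoulliMass h ^ p := by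
  set g := x.val.gcd n with hgdef
  have hg : 0 < g := Nat.gcd_pos_of_pos_right _ (Nat.pos_of_ne_zero (NeZero.ne n))
  have hs := summable_bernoulliMass_rpow hp
  have hnn : ∀ h, 0 ≤ bernoulliMass h ^ p := fun h => Real.rpow_nonneg (bernoulliMass_nonneg h) p
  have hle : ∀ h : ℤ, (solutionCount n x h : ℝ) * bernoulliMass h ^ p ≤
      if (g : ℤ) ∣ h then (g : ℝ) * bernoulliMass h ^ p else 0 := fun h => by
    have := solutionCount_le x h
    rw [← hgdef] at this
    split_ifs at this ⊢ with hd
    · have h' : (solutionCount n x h : ℝ) ≤ g := by exact_mod_cast this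
      gcongr
      exact hnn h
    · have h' : solutionCount n x h = 0 := by omega
      simp [h']
  have hsg : Summable fun h : ℤ => if (g : ℤ) ∣ h then (g : ℝ) * bernoulliMass h ^ p else 0 :=
    summable_ite (hs.mul_left _).norm _
  refine (Summable.tsum_le_tsum hle (Summable.of_nonneg_of_le (fun h => ?_) hle hsg) hsg).trans ?_
  · exact mul_nonneg (Nat.cast_nonneg _) (hnn h)
  have hinj : Function.Injective fun h : ℤ => (g : ℤ) * h :=
    mul_right_injective₀ (by exact_mod_cast hg.ne')
  rw [← hinj.tsum_eq]
  · refine Summable.tsum_le_tsum (fun h => ?_) (hsg.comp_injective hinj) hs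
    rw [if_pos (dvd_mul_right _ _), bernoulliMass_mul, Real.mul_rpow (by positivity)
      (bernoulliMass_nonneg h), ← mul_assoc]
    refine mul_le_of_le_one_left (hnn h) ?_
    have h1 : (1 : ℝ) ≤ g := by exact_mod_cast hg
    rw [Int.cast_natCast, Real.inv_rpow (by positivity), ← Real.rpow_two,
      ← Real.rpow_mul (by positivity), ← div_eq_mul_inv, div_le_one (by positivity)]
    simpa using Real.rpow_le_rpow_of_exponent_le h1 (show 1 ≤ 2 * p by linarith)
  · intro h hh
    simp only [Function.mem_support, ne_eq, ite_eq_right_iff, Classical.not_imp] at hh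
    obtain ⟨⟨k, rfl⟩, -⟩ := hh
    exact ⟨k, rfl⟩

/-- Averaging over the last component of the generating vector: the `p`-th powers of the Fourier
coefficients gain a factor `∑ₕ (bernoulliMass h) ^ p`, uniformly in `n`. -/
theorem sum_candidates_rpow_le {n : ℕ} [NeZero n] {c : ZMod n → ℝ} (hc : ∀ m, 0 ≤ c m)
    {p : ℝ} (hp : 1 / 2 < p) (hp1 : p ≤ 1) :
    ∑ w ∈ candidates n, (∑ m, residueMass n m * c (-(m * (w : ZMod n)))) ^ p ≤
      (∑ m, c m ^ p) * ∑' h, bernoulliMass h ^ p := by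
  have hp0 : 0 < p := by linarith
  have hcp : ∀ m, 0 ≤ c m ^ p := fun m => Real.rpow_nonneg (hc m) p
  calc _ ≤ ∑ w ∈ candidates n, ∑ m, residueMass n m ^ p * c (-(m * (w : ZMod n))) ^ p := by
        refine Finset.sum_le_sum fun w _ => ?_
        refine (rpow_sum_le_sum_rpow _ (fun m => mul_nonneg (residueMass_nonneg n m) (hc _))
          hp0 hp1).trans_eq ?_
        exact Finset.sum_congr rfl fun m _ => Real.mul_rpow (residueMass_nonneg n m) (hc _)
    _ = ∑ m, residueMass n m ^ p * ∑ x, c x ^ p * solutionCount n (-x) m := by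
        rw [Finset.sum_comm]
        refine Finset.sum_congr rfl fun m _ => ?_
        rw [← Finset.mul_sum]
        congr 1
        have : ∀ w : ℕ, c (-(m * (w : ZMod n))) ^ p =
            ∑ x, if m * (w : ZMod n) = -x then c x ^ p else 0 := fun w => by
          simp_rw [← neg_eq_iff_eq_neg]
          simp
        simp_rw [this]
        rw [Finset.sum_comm]
        refine Finset.sum_congr rfl fun x _ => ?_
        rw [← Finset.sum_filter, Finset.sum_const, nsmul_eq_mul, mul_comm, solutionCount]
    _ = ∑ x, c x ^ p * ∑ m, (solutionCount n (-x) m : ℝ) * residueMass n m ^ p := by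
        simp_rw [Finset.mul_sum]
        rw [Finset.sum_comm]
        exact Finset.sum_congr rfl fun x _ => Finset.sum_congr rfl fun m _ => by ring
    _ ≤ ∑ x, c x ^ p * ∑' h, bernoulliMass h ^ p := by
        gcongr with x _
        · exact hcp x
        · exact (sum_mul_residueMass_rpow_le (fun m => Nat.cast_nonneg _) hp hp1).trans
            (tsum_solutionCount_mul_le (-x) hp)
    _ = _ := by rw [Finset.sum_mul]

/-! ### Fourier coefficients of the lattice rule error -/

/-- The function `k ↦ ∏_{j ∈ u} B₂ (frac (k z_j / n))` has nonnegative discrete Fourier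
coefficients, whose `p`-th powers have a sum bounded independently of `n` and `z`. -/
theorem exists_fourier_coeffs {n : ℕ} [NeZero n] {ι : Type*} (z : ι → ℕ) (u : Finset ι) {p : ℝ}
    (hp : 1 / 2 < p) (hp1 : p ≤ 1) :
    ∃ c : ZMod n → ℝ, (∀ m, 0 ≤ c m) ∧
      (∀ k : ℕ, ((∏ j ∈ u, bernoulliFun 2 (Int.fract ((k : ℝ) * z j / n)) : ℝ) : ℂ) =
        ∑ m, (c m : ℂ) * ZMod.stdAddChar (m * (k : ZMod n))) ∧
      ∑ m, c m ^ p ≤ (∑' h, bernoulliMass h ^ p) ^ u.card := by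
  classical
  have hp0 : 0 < p := by linarith
  induction u using Finset.induction_on with
  | empty =>
    refine ⟨Pi.single 0 1, fun m => ?_, fun k => ?_, ?_⟩
    · by_cases h : m = 0 <;> simp [h]
    · rw [Finset.sum_eq_single 0] <;> simp +contextual
    · simp [Pi.single_apply, Real.zero_rpow hp0.ne', apply_ite (· ^ p)]
  | insert j u hj ih =>
    obtain ⟨c, hc, hsum, hle⟩ := ih
    refine ⟨fun m => ∑ m', residueMass n m' * c (m - m' * (z j : ZMod n)), fun m =>
      Finset.sum_nonneg fun m' _ => mul_nonneg (residueMass_nonneg n m') (hc _), fun k => ?_, ?_⟩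
    · rw [Finset.prod_insert hj, Complex.ofReal_mul, hsum k]
      have hb := bernoulliFun_two_eq_sum_residueMass (n := n) ((k : ℤ) * (z j : ℤ))
      push_cast at hb
      push_cast
      rw [hb, Finset.sum_mul]
      simp_rw [Finset.sum_mul]
      rw [Finset.sum_comm (γ := ZMod n)]
      refine Finset.sum_congr rfl fun m' _ => ?_
      rw [Finset.mul_sum]
      refine Fintype.sum_equiv (Equiv.addRight (m' * (z j : ZMod n))) _ _ fun m => ?_
      simp only [Equiv.coe_addRight, add_sub_cancel_right]
      rw [add_mul, AddChar.map_add_eq_mul]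
      ring_nf
    · rw [Finset.card_insert_of_notMem hj, pow_succ]
      have hone : ∑ m', residueMass n m' ^ p ≤ ∑' h, bernoulliMass h ^ p := by
        simpa using sum_mul_residueMass_rpow_le (n := n) (F := fun _ => 1)
          (fun _ => zero_le_one) hp hp1
      have hcp : ∀ m, 0 ≤ c m ^ p := fun m => Real.rpow_nonneg (hc m) p
      calc _ ≤ ∑ m, ∑ m', residueMass n m' ^ p * c (m - m' * (z j : ZMod n)) ^ p := by
            refine Finset.sum_le_sum fun m _ => ?_
            refine (rpow_sum_le_sum_rpow _ (fun m' => mul_nonneg (residueMass_nonneg n m') (hc _))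
              hp0 hp1).trans_eq ?_
            exact Finset.sum_congr rfl fun m' _ =>
              Real.mul_rpow (residueMass_nonneg n m') (hc _)
        _ = (∑ m, c m ^ p) * ∑ m', residueMass n m' ^ p := by
            rw [Finset.sum_comm, mul_comm, Finset.sum_mul]
            refine Finset.sum_congr rfl fun m' _ => ?_
            rw [← Finset.mul_sum]
            congr 1
            exact Fintype.sum_equiv (Equiv.subRight (m' * (z j : ZMod n))) _ _ fun m => rfl
        _ ≤ _ := by
            exact mul_le_mul hle hone (Finset.sum_nonneg fun m _ =>
              Real.rpow_nonneg (residueMass_nonneg n m) p)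
              ((Finset.sum_nonneg fun m _ => hcp m).trans hle)

theorem sum_range_stdAddChar {n : ℕ} [NeZero n] (x : ZMod n) :
    ∑ k ∈ Finset.range n, ZMod.stdAddChar (x * (k : ZMod n)) = if x = 0 then (n : ℂ) else 0 := by
  have h := AddChar.sum_mulShift x (ZMod.isPrimitive_stdAddChar n)
  simp only [ZMod.card, Nat.cast_ite, Nat.cast_zero] at h
  rw [← h]
  refine Finset.sum_nbij' (fun k => (k : ZMod n)) ZMod.val ?_ ?_ ?_ ?_ ?_
  · simp
  · intro a _; simpa using ZMod.val_lt a
  · intro k hk; simpa using ZMod.val_cast_of_lt (Finset.mem_range.1 hk)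
  · simp
  · intro k _; rw [mul_comm]

/-- The mean of `∏_{j ∈ u} B₂ (frac (k z_j / n))` over `k`. -/
noncomputable def latticeMean {ι : Type*} (n : ℕ) (z : ι → ℕ) (u : Finset ι) : ℝ :=
  1 / (n : ℝ) * ∑ k ∈ Finset.range n,
    ∏ j ∈ u, bernoulliFun 2 (Int.fract ((k : ℝ) * (z j : ℝ) / (n : ℝ)))

theorem latticeMean_congr {ι : Type*} (n : ℕ) {z z' : ι → ℕ} {u : Finset ι}
    (h : ∀ j ∈ u, z j = z' j) : latticeMean n z u = latticeMean n z' u := by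
  unfold latticeMean
  congr 1
  exact Finset.sum_congr rfl fun k _ => Finset.prod_congr rfl fun j hj => by rw [h j hj]

/-- The mean over `k` picks out the frequencies orthogonal to the generating vector. -/
theorem latticeMean_insert_eq {n : ℕ} [NeZero n] {ι : Type*} [DecidableEq ι] {z : ι → ℕ} {d : ι}
    {u : Finset ι} (hd : d ∉ u) {c : ZMod n → ℝ}
    (hsum : ∀ k : ℕ, ((∏ j ∈ u, bernoulliFun 2 (Int.fract ((k : ℝ) * z j / n)) : ℝ) : ℂ) =
        ∑ m, (c m : ℂ) * ZMod.stdAddChar (m * (k : ZMod n))) :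
    latticeMean n z (insert d u) = ∑ m, residueMass n m * c (-(m * (z d : ZMod n))) := by
  have hn : (n : ℂ) ≠ 0 := by exact_mod_cast NeZero.ne n
  apply Complex.ofReal_injective
  have hk : ∀ k : ℕ,
      ((∏ j ∈ insert d u, bernoulliFun 2 (Int.fract ((k : ℝ) * z j / n)) : ℝ) : ℂ) =
      ∑ m, ∑ m', (residueMass n m : ℂ) * (c m' : ℂ) *
        ZMod.stdAddChar ((m * (z d : ZMod n) + m') * (k : ZMod n)) := fun k => by
    rw [Finset.prod_insert hd, Complex.ofReal_mul, hsum k]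
    have hb := bernoulliFun_two_eq_sum_residueMass (n := n) ((k : ℤ) * (z d : ℤ))
    push_cast at hb
    rw [hb, Finset.sum_mul]
    refine Finset.sum_congr rfl fun m _ => ?_
    rw [Finset.mul_sum]
    refine Finset.sum_congr rfl fun m' _ => ?_
    rw [add_mul, AddChar.map_add_eq_mul]
    ring_nf
  unfold latticeMean
  rw [Complex.ofReal_mul, Complex.ofReal_sum]
  simp_rw [hk]
  rw [Finset.sum_comm, Complex.ofReal_sum, Finset.mul_sum]
  refine Finset.sum_congr rfl fun m _ => ?_
  rw [Finset.sum_comm]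
  simp_rw [← Finset.mul_sum, sum_range_stdAddChar, add_eq_zero_iff_neg_eq]
  rw [Finset.sum_eq_single (-(m * (z d : ZMod n)))]
  · simp; field_simp
  · intro b _ hb; rw [if_neg (Ne.symm hb)]; simp
  · simp

theorem latticeMean_nonneg {n : ℕ} [NeZero n] {ι : Type*} (z : ι → ℕ) {u : Finset ι}
    (hu : u.Nonempty) : 0 ≤ latticeMean n z u := by
  classical
  obtain ⟨d, hd⟩ := hu
  obtain ⟨c, hc, hsum, -⟩ :=
    exists_fourier_coeffs (n := n) z (u.erase d) (p := 1) (by norm_num) le_rfl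
  rw [← Finset.insert_erase hd, latticeMean_insert_eq (Finset.notMem_erase d u) hsum]
  exact Finset.sum_nonneg fun m _ => mul_nonneg (residueMass_nonneg n m) (hc _)

theorem sum_candidates_latticeMean_rpow_le {n : ℕ} [NeZero n] {ι : Type*} [DecidableEq ι]
    (z : ι → ℕ) {d : ι} {u : Finset ι} (hd : d ∉ u) {p : ℝ} (hp : 1 / 2 < p) (hp1 : p ≤ 1) :
    ∑ w ∈ candidates n, latticeMean n (Function.update z d w) (insert d u) ^ p ≤
      (∑' h, bernoulliMass h ^ p) ^ (insert d u).card := by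
  obtain ⟨c, hc, hsum, hle⟩ := exists_fourier_coeffs (n := n) z u hp hp1
  have : ∀ w, latticeMean n (Function.update z d w) (insert d u) =
      ∑ m, residueMass n m * c (-(m * (w : ZMod n))) := fun w => by
    rw [latticeMean_insert_eq (c := c) hd, Function.update_self]
    intro k
    rw [← hsum k]
    congr 1
    refine Finset.prod_congr rfl fun j hj => ?_
    rw [Function.update_of_ne (ne_of_mem_of_not_mem hj hd)]
  simp_rw [this]
  refine (sum_candidates_rpow_le hc hp hp1).trans ?_
  rw [Finset.card_insert_of_notMem hd, pow_succ]
  exact mul_le_mul_of_nonneg_right hle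
    (tsum_nonneg fun h => Real.rpow_nonneg (bernoulliMass_nonneg h) p)

/-! ### The component-by-component construction -/

theorem sum_nonempty_powerset_insert {ι : Type*} [DecidableEq ι] {d : ι} {T : Finset ι}
    (hd : d ∉ T) (F : Finset ι → ℝ) :
    ∑ u ∈ (insert d T).powerset with u.Nonempty, F u =
      ∑ u ∈ T.powerset with u.Nonempty, F u + ∑ u ∈ T.powerset, F (insert d u) := by
  simp [Finset.sum_filter, Finset.sum_powerset_insert hd]

theorem card_candidates {n : ℕ} : (candidates n).card = n.totient := by
  rw [← Nat.filter_coprime_Ico_eq_totient n 1]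
  congr 1
  ext w
  simp only [candidates, Finset.mem_filter, Finset.mem_Icc, Finset.mem_Ico, Nat.coprime_comm]
  omega

theorem shiftAvgError_eq {s n : ℕ} (γ : Finset (Fin s) → ℝ) (d : Fin s) (z : Fin s → ℕ) :
    shiftAvgError n γ d z =
      ∑ u ∈ (Finset.Iic d).powerset with u.Nonempty, γ u * latticeMean n z u := rfl

theorem shiftAvgError_congr {s n : ℕ} (γ : Finset (Fin s) → ℝ) (d : Fin s) {z z' : Fin s → ℕ}
    (h : ∀ j ≤ d, z j = z' j) : shiftAvgError n γ d z = shiftAvgError n γ d z' := by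
  rw [shiftAvgError_eq, shiftAvgError_eq]
  refine Finset.sum_congr rfl fun u hu => ?_
  rw [latticeMean_congr n fun j hj => h j ?_]
  exact Finset.mem_Iic.1 (Finset.mem_powerset.1 (Finset.mem_filter.1 hu).1 hj)

/-- The construction never gets stuck: `1` is a candidate, and a later choice does not affect the
errors that were minimized before. -/
theorem exists_isCBC {s n : ℕ} (hn : 1 ≤ n) (γ : Finset (Fin s) → ℝ) :
    ∃ z : Fin s → ℕ, IsCBC n γ z := by
  suffices h : ∀ m ≤ s, ∃ z : Fin s → ℕ, ∀ d : Fin s, d.val < m → z d ∈ candidates n ∧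
      ∀ w ∈ candidates n, shiftAvgError n γ d z ≤ shiftAvgError n γ d (Function.update z d w) by
    obtain ⟨z, hz⟩ := h s le_rfl
    exact ⟨z, fun d => hz d d.2⟩
  intro m
  induction m with
  | zero => exact fun _ => ⟨fun _ => 0, fun d hd => absurd hd (Nat.not_lt_zero _)⟩
  | succ m ih =>
    intro hm
    obtain ⟨z, hz⟩ := ih (by omega)
    let d : Fin s := ⟨m, hm⟩
    obtain ⟨w₀, hw₀, hmin⟩ := (candidates n).exists_min_image
      (fun w => shiftAvgError n γ d (Function.update z d w)) ⟨1, by simp [candidates, hn]⟩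
    refine ⟨Function.update z d w₀, fun e he => ?_⟩
    rcases Nat.lt_succ_iff_lt_or_eq.1 he with hlt | heq
    · have hne : ∀ j ≤ e, j ≠ d := fun j hj hjd => by
        have h1 : j.val ≤ e.val := hj
        have h2 : j.val = m := by rw [hjd]
        omega
      obtain ⟨h1, h2⟩ := hz e hlt
      refine ⟨by rwa [Function.update_of_ne (hne e le_rfl)], fun w hw => ?_⟩
      rw [shiftAvgError_congr γ e (z' := z) fun j hj => Function.update_of_ne (hne j hj) _ _,
        shiftAvgError_congr γ e (z := Function.update (Function.update z d w₀) e w)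
          (z' := Function.update z e w) fun j hj => ?_]
      · exact h2 w hw
      · rw [Function.update_comm (hne e le_rfl).symm, Function.update_of_ne (hne j hj)]
    · obtain rfl : e = d := Fin.ext heq
      simpa [hw₀] using hmin

/-- The component chosen last contributes at most the mean over all candidates, and concave powers
are subadditive. -/
theorem cbc_increment_rpow_le {s n : ℕ} [NeZero n] {γ : Finset (Fin s) → ℝ} (hγ : ∀ u, 0 < γ u)
    {z : Fin s → ℕ} {d : Fin s} {T : Finset (Fin s)} (hd : d ∉ T)
    (hmin : ∀ w ∈ candidates n, ∑ u ∈ T.powerset, γ (insert d u) * latticeMean n z (insert d u) ≤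
      ∑ u ∈ T.powerset, γ (insert d u) * latticeMean n (Function.update z d w) (insert d u))
    {p : ℝ} (hp : 1 / 2 < p) (hp1 : p ≤ 1) :
    n.totient * (∑ u ∈ T.powerset, γ (insert d u) * latticeMean n z (insert d u)) ^ p ≤
      ∑ u ∈ T.powerset, γ (insert d u) ^ p * (∑' h, bernoulliMass h ^ p) ^ (insert d u).card := by
  have hp0 : 0 < p := by linarith
  have hnn : ∀ (z : Fin s → ℕ) u, 0 ≤ γ (insert d u) * latticeMean n z (insert d u) :=
    fun z u => mul_nonneg (hγ _).le (latticeMean_nonneg z (Finset.insert_nonempty _ _))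
  calc _ ≤ ∑ w ∈ candidates n, (∑ u ∈ T.powerset,
        γ (insert d u) * latticeMean n (Function.update z d w) (insert d u)) ^ p := by
        rw [← card_candidates, ← nsmul_eq_mul]
        exact Finset.card_nsmul_le_sum _ _ _ fun w hw =>
          Real.rpow_le_rpow (Finset.sum_nonneg fun u _ => hnn z u) (hmin w hw) hp0.le
    _ ≤ ∑ w ∈ candidates n, ∑ u ∈ T.powerset,
        γ (insert d u) ^ p * latticeMean n (Function.update z d w) (insert d u) ^ p := by
        refine Finset.sum_le_sum fun w _ => ?_
        refine (rpow_sum_le_sum_rpow _ (fun u => hnn _ u) hp0 hp1).trans_eq ?_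
        exact Finset.sum_congr rfl fun u _ => Real.mul_rpow (hγ _).le
          (latticeMean_nonneg _ (Finset.insert_nonempty _ _))
    _ ≤ _ := by
        rw [Finset.sum_comm]
        refine Finset.sum_le_sum fun u hu => ?_
        rw [← Finset.mul_sum]
        exact mul_le_mul_of_nonneg_left (sum_candidates_latticeMean_rpow_le z
          (fun h => hd (Finset.mem_powerset.1 hu h)) hp hp1) (Real.rpow_nonneg (hγ _).le p)

/-- The partial vector of the first `m` components satisfies the bound for `m` coordinates. -/
theorem sum_latticeMean_rpow_le_of_isCBC {s n : ℕ} [NeZero n] {γ : Finset (Fin s) → ℝ}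
    (hγ : ∀ u, 0 < γ u) {z : Fin s → ℕ} (hz : IsCBC n γ z) {p : ℝ} (hp : 1 / 2 < p)
    (hp1 : p ≤ 1) {m : ℕ} (hm : m ≤ s) :
    n.totient *
      (∑ u ∈ {j : Fin s | j.val < m}.toFinset.powerset with u.Nonempty,
        γ u * latticeMean n z u) ^ p ≤
      ∑ u ∈ {j : Fin s | j.val < m}.toFinset.powerset with u.Nonempty,
        γ u ^ p * (∑' h, bernoulliMass h ^ p) ^ u.card := by
  have hp0 : 0 < p := by linarith
  induction m with
  | zero => simp [Finset.filter_singleton, Real.zero_rpow hp0.ne']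
  | succ m ih =>
    let d : Fin s := ⟨m, hm⟩
    set T : Finset (Fin s) := {j : Fin s | j.val < m}.toFinset with hT
    have hd : d ∉ T := by simp [hT, d]
    have hins : {j : Fin s | j.val < m + 1}.toFinset = insert d T := by
      ext j
      simp only [hT, Set.mem_toFinset, Set.mem_ofPred_eq, Finset.mem_insert, Fin.ext_iff, d]
      omega
    have hIic : Finset.Iic d = insert d T := by
      ext j
      simp only [hT, Set.mem_toFinset, Set.mem_ofPred_eq, Finset.mem_insert, Fin.ext_iff, d,
        Finset.mem_Iic, Fin.le_def]
      omega
    rw [hins, sum_nonempty_powerset_insert hd, sum_nonempty_powerset_insert hd]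
    have hinc := cbc_increment_rpow_le (n := n) hγ hd (z := z) (fun w hw => ?_) hp hp1
    · refine (mul_le_mul_of_nonneg_left (Real.rpow_add_le_add_rpow ?_ ?_ hp0.le hp1)
        (Nat.cast_nonneg _)).trans ?_
      · exact Finset.sum_nonneg fun u hu => mul_nonneg (hγ u).le
          (latticeMean_nonneg z (Finset.mem_filter.1 hu).2)
      · exact Finset.sum_nonneg fun u hu => mul_nonneg (hγ _).le
          (latticeMean_nonneg z (Finset.insert_nonempty _ _))
      · rw [mul_add]
        exact add_le_add (ih (by omega)) hinc
    · have h := (hz d).2 w hw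
      rw [shiftAvgError_eq, shiftAvgError_eq, hIic, sum_nonempty_powerset_insert hd,
        sum_nonempty_powerset_insert hd] at h
      have hsame : ∑ u ∈ T.powerset with u.Nonempty,
          γ u * latticeMean n (Function.update z d w) u =
          ∑ u ∈ T.powerset with u.Nonempty, γ u * latticeMean n z u := by
        refine Finset.sum_congr rfl fun u hu => ?_
        rw [latticeMean_congr n fun j hj => Function.update_of_ne (ne_of_mem_of_not_mem
          (Finset.mem_powerset.1 (Finset.mem_filter.1 hu).1 hj) hd) _ _]
      rw [hsame] at h
      linarith

/-- The error bound for the vectors produced by the component-by-component construction. -/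
theorem sum_latticeMean_le_of_isCBC {s n : ℕ} [NeZero n] {γ : Finset (Fin s) → ℝ}
    (hγ : ∀ u, 0 < γ u) {z : Fin s → ℕ} (hz : IsCBC n γ z) {p : ℝ} (hp : 1 / 2 < p)
    (hp1 : p ≤ 1) :
    ∑ u : Finset (Fin s) with u.Nonempty, γ u * latticeMean n z u ≤
      (∑ u : Finset (Fin s) with u.Nonempty, γ u ^ p *
        (2 * (riemannZeta ((2 * p : ℝ) : ℂ)).re / (2 * Real.pi ^ 2) ^ p) ^ u.card) ^ (1 / p) *
      (n.totient : ℝ) ^ (-(1 / p)) := by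
  have hp0 : 0 < p := by linarith
  have hφ : (0 : ℝ) < n.totient := by
    exact_mod_cast Nat.totient_pos.2 (Nat.pos_of_ne_zero (NeZero.ne n))
  have h := sum_latticeMean_rpow_le_of_isCBC hγ hz hp hp1 le_rfl
  have hT : ({j : Fin s | j.val < s}.toFinset).powerset = Finset.univ := by
    simp
  rw [hT, tsum_bernoulliMass_rpow hp] at h
  set A := ∑ u : Finset (Fin s) with u.Nonempty, γ u * latticeMean n z u
  have hA : 0 ≤ A := Finset.sum_nonneg fun u hu => mul_nonneg (hγ u).le
    (latticeMean_nonneg z (Finset.mem_filter.1 hu).2)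
  have h2 := Real.rpow_le_rpow (by positivity) h (show 0 ≤ 1 / p by positivity)
  rw [Real.mul_rpow hφ.le (by positivity), ← Real.rpow_mul hA, mul_one_div_cancel hp0.ne',
    Real.rpow_one] at h2
  rw [Real.rpow_neg hφ.le, ← div_eq_mul_inv, le_div_iff₀ (by positivity), mul_comm]
  exact h2

theorem one_div_totient_le_of_isPrimePow {n : ℕ} (hn : IsPrimePow n) :
    1 / (n.totient : ℝ) ≤ 2 / (n : ℝ) := by
  obtain ⟨q, k, hq, hk, rfl⟩ := hn
  have hq' : q.Prime := hq.nat_prime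
  obtain ⟨k, rfl⟩ := Nat.exists_eq_succ_of_ne_zero hk.ne'
  rw [Nat.totient_prime_pow_succ hq']
  have h2 : (2 : ℝ) ≤ q := by exact_mod_cast hq'.two_le
  push_cast [Nat.cast_sub hq'.one_le]
  have hqk : (0 : ℝ) < (q : ℝ) ^ k := by positivity
  rw [div_le_div_iff₀ (mul_pos hqk (by linarith)) (by positivity), pow_succ]
  nlinarith

/-! ### The one-dimensional representation and its kernel -/

/-- The uniform distribution on `[-1/2, 1/2]`. -/
noncomputable def unif : Measure ℝ := volume.restrict (Set.Icc (-(1 / 2)) (1 / 2))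

instance : IsProbabilityMeasure unif :=
  ⟨by rw [unif, Measure.restrict_apply_univ, Real.volume_Icc]; norm_num⟩

theorem ae_unif_mem : ∀ᵐ t ∂unif, t ∈ Set.Icc (-(1 / 2) : ℝ) (1 / 2) :=
  ae_restrict_mem measurableSet_Icc

theorem integral_unif {E : Type*} [NormedAddCommGroup E] [NormedSpace ℝ E] (f : ℝ → E) :
    ∫ t, f t ∂unif = ∫ t in (-(1 / 2))..(1 / 2), f t := by
  rw [unif, integral_Icc_eq_integral_Ioc, intervalIntegral.integral_of_le (by norm_num)]

/-- The Peano kernel that recovers the value of a function at `y` from its mean over `[-1/2, 1/2]`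
and its derivative. -/
noncomputable def peanoKernel (y t : ℝ) : ℝ := if t ≤ y then t + 1 / 2 else t - 1 / 2

theorem measurable_peanoKernel : Measurable fun p : ℝ × ℝ => peanoKernel p.1 p.2 :=
  Measurable.ite (measurableSet_le measurable_snd measurable_fst) (by fun_prop) (by fun_prop)

theorem abs_peanoKernel_le {y t : ℝ} (ht : t ∈ Set.Icc (-(1 / 2) : ℝ) (1 / 2)) :
    |peanoKernel y t| ≤ 1 := by
  unfold peanoKernel
  split_ifs <;> rw [abs_le] <;> constructor <;> linarith [ht.1, ht.2]

/-- The Peano kernel formula: integrate by parts separately on the two sides of `y`. -/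
theorem eq_integral_add_integral_peanoKernel {E : Type*} [NormedAddCommGroup E] [NormedSpace ℝ E]
    [CompleteSpace E] {f f' : ℝ → E}
    (hf : ∀ t ∈ Set.Icc (-(1 / 2) : ℝ) (1 / 2),
      HasDerivWithinAt f (f' t) (Set.Icc (-(1 / 2)) (1 / 2)) t)
    (hf' : Integrable f' unif) {y : ℝ} (hy : y ∈ Set.Icc (-(1 / 2) : ℝ) (1 / 2)) :
    f y = (∫ t, f t ∂unif) + ∫ t, peanoKernel y t • f' t ∂unif := by
  have hcont : ContinuousOn f (Set.Icc (-(1 / 2)) (1 / 2)) := fun t ht =>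
    (hf t ht).continuousWithinAt
  have hfint : Integrable f unif := hcont.integrableOn_Icc
  have hkm : Measurable (peanoKernel y) := measurable_peanoKernel.comp measurable_prodMk_left
  have hkint : Integrable (fun t => peanoKernel y t • f' t) unif :=
    hf'.bdd_smul 1 hkm.aestronglyMeasurable (by
      filter_upwards [ae_unif_mem] with t ht using by simpa using abs_peanoKernel_le ht)
  -- The derivative of `(t - a) • f t`, integrated over a subinterval.
  have piece : ∀ a b c : ℝ, b ≤ c → -(1 / 2) ≤ b → c ≤ 1 / 2 →
      IntervalIntegrable (fun t => f t + (t - a) • f' t) volume b c ∧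
      ∫ t in b..c, f t + (t - a) • f' t = (c - a) • f c - (b - a) • f b := by
    intro a b c hbc hb hc
    have hsub : Set.Icc b c ⊆ Set.Icc (-(1 / 2)) (1 / 2) := Set.Icc_subset_Icc hb hc
    have hii : IntervalIntegrable (fun t => f t + (t - a) • f' t) volume b c := by
      rw [intervalIntegrable_iff_integrableOn_Icc_of_le hbc]
      refine IntegrableOn.add (hfint.mono_measure (Measure.restrict_mono hsub le_rfl)) ?_
      exact IntegrableOn.continuousOn_smul
        (hf'.mono_measure (Measure.restrict_mono hsub le_rfl)) (by fun_prop) isCompact_Icc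
    refine ⟨hii, ?_⟩
    refine intervalIntegral.integral_eq_sub_of_hasDerivAt_of_le hbc
      (f := fun t => (t - a) • f t) ?_ (fun t ht => ?_) hii
    · exact ContinuousOn.smul (by fun_prop) (hcont.mono hsub)
    · have h1 : HasDerivAt f (f' t) t := (hf t (hsub (Set.Ioo_subset_Icc_self ht))).hasDerivAt
        (Icc_mem_nhds (by linarith [ht.1]) (by linarith [ht.2]))
      have h2 := ((hasDerivAt_id t).sub_const a).smul h1
      exact h2.congr_deriv (by simp [add_comm])
  obtain ⟨i1, e1⟩ := piece (-(1 / 2)) (-(1 / 2)) y hy.1 le_rfl hy.2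
  obtain ⟨i2, e2⟩ := piece (1 / 2) y (1 / 2) hy.2 hy.1 le_rfl
  -- Up to `y` take `a = -1/2`, beyond `y` take `a = 1/2`: the boundary terms at `±1/2` vanish.
  have c1 : Set.EqOn (fun t => f t + (t - -(1 / 2)) • f' t)
      (fun t => f t + peanoKernel y t • f' t) (Set.uIoo (-(1 / 2)) y) := fun t ht => by
    rw [Set.uIoo_of_le hy.1] at ht
    simp only [peanoKernel, if_pos ht.2.le, sub_neg_eq_add]
  have c2 : Set.EqOn (fun t => f t + (t - 1 / 2) • f' t)
      (fun t => f t + peanoKernel y t • f' t) (Set.uIoo y (1 / 2)) := fun t ht => by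
    rw [Set.uIoo_of_le hy.2] at ht
    simp only [peanoKernel, if_neg (not_le.2 ht.1)]
  rw [intervalIntegral.integral_congr_uIoo c1] at e1
  rw [intervalIntegral.integral_congr_uIoo c2] at e2
  rw [← integral_add hfint hkint, integral_unif,
    ← intervalIntegral.integral_add_adjacent_intervals (i1.congr_uIoo c1) (i2.congr_uIoo c2),
    e1, e2]
  module

/-- The kernel `∫ k(x, t) k(y, t) dt` belonging to the Peano kernel, in the variables
`x + 1/2` and `y + 1/2`. -/
noncomputable def peanoGram (X Y : ℝ) : ℝ := 1 / 3 - max X Y + (X ^ 2 + Y ^ 2) / 2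

theorem peanoGram_comm (X Y : ℝ) : peanoGram X Y = peanoGram Y X := by
  simp only [peanoGram, max_comm, add_comm]

theorem integral_peanoKernel_mul_of_le {X Y : ℝ} (hX : 0 ≤ X) (hXY : X ≤ Y) (hY : Y ≤ 1) :
    ∫ t, peanoKernel (X - 1 / 2) t * peanoKernel (Y - 1 / 2) t ∂unif = peanoGram X Y := by
  rw [integral_unif]
  have c1 : Set.EqOn (fun t => (t + 1 / 2) * (t + 1 / 2))
      (fun t => peanoKernel (X - 1 / 2) t * peanoKernel (Y - 1 / 2) t)
      (Set.uIoo (-(1 / 2)) (X - 1 / 2)) := fun t ht => by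
    rw [Set.uIoo_of_le (by linarith)] at ht
    simp only [peanoKernel, if_pos ht.2.le, if_pos (show t ≤ Y - 1 / 2 by linarith [ht.2])]
  have c2 : Set.EqOn (fun t => (t - 1 / 2) * (t + 1 / 2))
      (fun t => peanoKernel (X - 1 / 2) t * peanoKernel (Y - 1 / 2) t)
      (Set.uIoo (X - 1 / 2) (Y - 1 / 2)) := fun t ht => by
    rw [Set.uIoo_of_le (by linarith)] at ht
    simp only [peanoKernel, if_neg (not_le.2 ht.1), if_pos ht.2.le]
  have c3 : Set.EqOn (fun t => (t - 1 / 2) * (t - 1 / 2))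
      (fun t => peanoKernel (X - 1 / 2) t * peanoKernel (Y - 1 / 2) t)
      (Set.uIoo (Y - 1 / 2) (1 / 2)) := fun t ht => by
    rw [Set.uIoo_of_le (by linarith)] at ht
    simp only [peanoKernel, if_neg (not_le.2 ht.1),
      if_neg (show ¬ t ≤ X - 1 / 2 by linarith [ht.1])]
  have i1 : IntervalIntegrable (fun t : ℝ => (t + 1 / 2) * (t + 1 / 2)) volume
      (-(1 / 2)) (X - 1 / 2) := Continuous.intervalIntegrable (by fun_prop) _ _
  have i2 : IntervalIntegrable (fun t : ℝ => (t - 1 / 2) * (t + 1 / 2)) volume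
      (X - 1 / 2) (Y - 1 / 2) := Continuous.intervalIntegrable (by fun_prop) _ _
  have i3 : IntervalIntegrable (fun t : ℝ => (t - 1 / 2) * (t - 1 / 2)) volume
      (Y - 1 / 2) (1 / 2) := Continuous.intervalIntegrable (by fun_prop) _ _
  rw [← intervalIntegral.integral_add_adjacent_intervals
      ((i1.congr_uIoo c1).trans (i2.congr_uIoo c2)) (i3.congr_uIoo c3),
    ← intervalIntegral.integral_add_adjacent_intervals (i1.congr_uIoo c1) (i2.congr_uIoo c2),
    ← intervalIntegral.integral_congr_uIoo c1, ← intervalIntegral.integral_congr_uIoo c2,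
    ← intervalIntegral.integral_congr_uIoo c3,
    intervalIntegral.integral_eq_sub_of_hasDerivAt (f := fun t => (t + 1 / 2) ^ 3 / 3)
      (fun t _ => ?_) i1,
    intervalIntegral.integral_eq_sub_of_hasDerivAt (f := fun t => t ^ 3 / 3 - t / 4)
      (fun t _ => ?_) i2,
    intervalIntegral.integral_eq_sub_of_hasDerivAt (f := fun t => (t - 1 / 2) ^ 3 / 3)
      (fun t _ => ?_) i3]
  · rw [peanoGram, max_eq_right hXY]
    ring
  · have := (((hasDerivAt_id t).sub_const (1 / 2)).pow 3).div_const 3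
    exact this.congr_deriv (by simp; ring)
  · have := (((hasDerivAt_id t).pow 3).div_const 3).sub ((hasDerivAt_id t).div_const 4)
    exact this.congr_deriv (by simp; ring)
  · have := (((hasDerivAt_id t).add_const (1 / 2)).pow 3).div_const 3
    exact this.congr_deriv (by simp; ring)

theorem integral_peanoKernel_mul {X Y : ℝ} (hX : X ∈ Set.Icc (0 : ℝ) 1)
    (hY : Y ∈ Set.Icc (0 : ℝ) 1) :
    ∫ t, peanoKernel (X - 1 / 2) t * peanoKernel (Y - 1 / 2) t ∂unif = peanoGram X Y := by
  rcases le_total X Y with h | h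
  · exact integral_peanoKernel_mul_of_le hX.1 h hY.2
  · simp_rw [mul_comm (peanoKernel (X - 1 / 2) _)]
    rw [integral_peanoKernel_mul_of_le hY.1 h hX.2, peanoGram_comm]

theorem measurable_peanoGram_fract (a b : ℝ) :
    Measurable fun δ => peanoGram (Int.fract (a + δ)) (Int.fract (b + δ)) := by
  unfold peanoGram; fun_prop

theorem abs_peanoGram_le {X Y : ℝ} (hX : X ∈ Set.Icc (0 : ℝ) 1) (hY : Y ∈ Set.Icc (0 : ℝ) 1) :
    |peanoGram X Y| ≤ 2 := by
  obtain ⟨h1, h2⟩ := hX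
  obtain ⟨h3, h4⟩ := hY
  unfold peanoGram
  rcases max_cases X Y with ⟨h, _⟩ | ⟨h, _⟩ <;> rw [h, abs_le] <;> constructor <;> nlinarith

/-- Averaging the kernel over a random shift leaves the second Bernoulli polynomial of the
difference. -/
theorem integral_peanoGram_fract (a b : ℝ) :
    ∫ δ in Set.Icc (0 : ℝ) 1, peanoGram (Int.fract (a + δ)) (Int.fract (b + δ)) =
      bernoulliFun 2 (Int.fract (a - b)) := by
  rw [integral_Icc_eq_integral_Ioc, ← intervalIntegral.integral_of_le zero_le_one]
  set c := Int.fract (a - b) with hc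
  have hc0 : 0 ≤ c := Int.fract_nonneg _
  have hc1 : c < 1 := Int.fract_lt_one _
  let G : ℝ → ℝ := fun δ => peanoGram (Int.fract (c + δ)) (Int.fract δ)
  have hG : Function.Periodic G 1 := fun δ => by
    simp only [G, ← add_assoc, Int.fract_add_one]
  have h1 : ∀ δ, peanoGram (Int.fract (a + δ)) (Int.fract (b + δ)) = G (δ + b) := fun δ => by
    have : a + δ = c + (δ + b) + (⌊a - b⌋ : ℤ) := by
      rw [hc]; linarith [Int.fract_add_floor (a - b)]
    simp only [G]
    rw [this, Int.fract_add_intCast, add_comm b]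
  simp_rw [h1]
  rw [intervalIntegral.integral_comp_add_right, zero_add, add_comm 1 b,
    hG.intervalIntegral_add_eq b 0, zero_add]
  -- On `(0, 1 - c)` no wrap-around occurs and `frac (c + δ) = c + δ` is the larger argument; on
  -- `(1 - c, 1)` it equals `c + δ - 1` and is the smaller one.
  have c1 : Set.EqOn (fun δ => 1 / 3 - (c + δ) + ((c + δ) ^ 2 + δ ^ 2) / 2) G
      (Set.uIoo 0 (1 - c)) := fun δ hδ => by
    rw [Set.uIoo_of_le (by linarith)] at hδ
    simp only [G, peanoGram]
    rw [Int.fract_eq_self.2 ⟨by linarith [hδ.1], by linarith [hδ.2]⟩,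
      Int.fract_eq_self.2 ⟨by linarith [hδ.1], by linarith [hδ.2]⟩, max_eq_left (by linarith)]
  have c2 : Set.EqOn (fun δ => 1 / 3 - δ + ((c + δ - 1) ^ 2 + δ ^ 2) / 2) G
      (Set.uIoo (1 - c) 1) := fun δ hδ => by
    rw [Set.uIoo_of_le (by linarith)] at hδ
    simp only [G, peanoGram]
    rw [← Int.fract_sub_one (c + δ),
      Int.fract_eq_self.2 ⟨by linarith [hδ.1], by linarith [hδ.2]⟩,
      Int.fract_eq_self.2 ⟨by linarith [hδ.1], by linarith [hδ.2]⟩, max_eq_right (by linarith)]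
  have i1 : IntervalIntegrable (fun δ : ℝ => 1 / 3 - (c + δ) + ((c + δ) ^ 2 + δ ^ 2) / 2) volume
      0 (1 - c) := Continuous.intervalIntegrable (by fun_prop) _ _
  have i2 : IntervalIntegrable (fun δ : ℝ => 1 / 3 - δ + ((c + δ - 1) ^ 2 + δ ^ 2) / 2) volume
      (1 - c) 1 := Continuous.intervalIntegrable (by fun_prop) _ _
  rw [← intervalIntegral.integral_add_adjacent_intervals (i1.congr_uIoo c1) (i2.congr_uIoo c2),
    ← intervalIntegral.integral_congr_uIoo c1, ← intervalIntegral.integral_congr_uIoo c2,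
    intervalIntegral.integral_eq_sub_of_hasDerivAt
      (f := fun δ => δ / 3 - (c + δ) ^ 2 / 2 + ((c + δ) ^ 3 / 3 + δ ^ 3 / 3) / 2)
      (fun t _ => ?_) i1,
    intervalIntegral.integral_eq_sub_of_hasDerivAt
      (f := fun δ => δ / 3 - δ ^ 2 / 2 + ((c + δ - 1) ^ 3 / 3 + δ ^ 3 / 3) / 2)
      (fun t _ => ?_) i2, bernoulliFun_two]
  · ring
  · have hid := hasDerivAt_id t
    have := ((hid.div_const 3).sub ((hid.pow 2).div_const 2)).add
      ((((((hid.const_add c).sub_const 1).pow 3).div_const 3).add ((hid.pow 3).div_const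
        3)).div_const 2)
    exact this.congr_deriv (by simp)
  · have hid := hasDerivAt_id t
    have := ((hid.div_const 3).sub (((hid.const_add c).pow 2).div_const 2)).add
      (((((hid.const_add c).pow 3).div_const 3).add ((hid.pow 3).div_const 3)).div_const 2)
    exact this.congr_deriv (by simp)

/-! ### The representation on the cube -/

/-- The uniform distribution on the cube. -/
noncomputable def cubeUnif (s : ℕ) : Measure (Fin s → ℝ) := Measure.pi fun _ => unif

instance (s : ℕ) : IsProbabilityMeasure (cubeUnif s) := by unfold cubeUnif; infer_instance

theorem mem_cube {s : ℕ} {y : Fin s → ℝ} :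
    y ∈ cube s ↔ ∀ j, y j ∈ Set.Icc (-(1 / 2) : ℝ) (1 / 2) := by
  simp [cube, Set.mem_Icc, Pi.le_def, forall_and]

theorem measurableSet_cube (s : ℕ) : MeasurableSet (cube s) := measurableSet_Icc

theorem restrict_cube (s : ℕ) : volume.restrict (cube s) = cubeUnif s := by
  rw [cube, ← Set.pi_univ_Icc, volume_pi, Measure.restrict_pi_pi]
  rfl

theorem ae_cubeUnif_mem (s : ℕ) : ∀ᵐ t ∂cubeUnif s, t ∈ cube s := by
  rw [← restrict_cube]
  exact ae_restrict_mem (measurableSet_cube s)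

theorem update_mem_cube {s : ℕ} {y : Fin s → ℝ} (hy : y ∈ cube s) (j : Fin s) {t : ℝ}
    (ht : t ∈ Set.Icc (-(1 / 2) : ℝ) (1 / 2)) : Function.update y j t ∈ cube s := by
  rw [mem_cube] at hy ⊢
  intro i
  by_cases h : i = j
  · subst h; simpa using ht
  · simpa [h] using hy i

theorem piecewise_mem_cube {s : ℕ} {t y : Fin s → ℝ} (ht : t ∈ cube s) (hy : y ∈ cube s)
    (A : Finset (Fin s)) : A.piecewise t y ∈ cube s := by
  rw [mem_cube] at ht hy ⊢
  intro i
  by_cases h : i ∈ A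
  · simpa [h] using ht i
  · simpa [h] using hy i

/-- Resampling one coordinate of a random vector with independent coordinates. -/
theorem measurePreserving_update {ι : Type*} [Fintype ι] [DecidableEq ι] (μ : ι → Measure ℝ)
    [∀ i, IsProbabilityMeasure (μ i)] (a : ι) :
    MeasurePreserving (fun p : (ι → ℝ) × ℝ => Function.update p.1 a p.2)
      ((Measure.pi μ).prod (μ a)) (Measure.pi μ) := by
  have hm : Measurable fun p : (ι → ℝ) × ℝ => Function.update p.1 a p.2 := by
    refine measurable_pi_iff.2 fun i => ?_
    by_cases h : i = a
    · subst h; simpa using measurable_snd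
    · simpa [h, Function.comp_def] using (measurable_pi_apply i).comp measurable_fst
  refine ⟨hm, (Measure.pi_eq fun S hS => ?_).symm⟩
  have hpre : (fun p : (ι → ℝ) × ℝ => Function.update p.1 a p.2) ⁻¹' (Set.univ.pi S) =
      (Set.univ.pi (Function.update S a Set.univ)) ×ˢ S a := by
    ext p
    simp only [Set.mem_preimage, Set.mem_pi, Set.mem_univ, true_imp_iff, Set.mem_prod]
    constructor
    · refine fun h => ⟨fun i => ?_, by simpa using h a⟩
      by_cases hi : i = a
      · subst hi; simp
      · simpa [hi] using h i
    · rintro ⟨h, ha⟩ i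
      by_cases hi : i = a
      · subst hi; simpa using ha
      · simpa [hi] using h i
  rw [Measure.map_apply hm (MeasurableSet.univ_pi hS), hpre, Measure.prod_prod, Measure.pi_pi,
    ← Finset.mul_prod_erase Finset.univ _ (Finset.mem_univ a),
    ← Finset.mul_prod_erase Finset.univ (fun i => μ i (S i)) (Finset.mem_univ a)]
  simp only [Function.update_self, measure_univ, one_mul]
  rw [mul_comm]
  congr 1
  refine Finset.prod_congr rfl fun i hi => ?_
  rw [Function.update_of_ne (Finset.ne_of_mem_erase hi)]

section Representation

variable {s : ℕ} {Z : Type*} [NormedAddCommGroup Z] [NormedSpace ℝ Z]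
  {g : (Fin s → ℝ) → Z} {D : Finset (Fin s) → (Fin s → ℝ) → Z}

/-- A mixed derivative is measurable on the cube, as a pointwise limit of difference quotients
that point into the cube. -/
theorem stronglyMeasurable_indicator_deriv [TopologicalSpace.SeparableSpace Z]
    (hg : ContinuousOn g (cube s)) (hD : HasMixedDerivs g D) (u : Finset (Fin s)) :
    StronglyMeasurable ((cube s).indicator (D u)) := by
  borelize Z
  have := UniformSpace.secondCountable_of_separable Z
  induction u using Finset.induction_on with
  | empty =>
    classical
    have : (cube s).indicator (D ∅) = (cube s).piecewise g 0 := by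
      rw [Set.piecewise_eq_indicator]
      exact Set.indicator_congr hD.1
    rw [this]
    exact (hg.measurable_piecewise (g := 0) continuousOn_const
      (measurableSet_cube s)).stronglyMeasurable
  | insert j u hj ih =>
    -- The step goes towards the centre and has length at most `1/2`, so it stays in the cube.
    let τ : ℕ → (Fin s → ℝ) → ℝ := fun m y =>
      if y j ≤ 0 then y j + 1 / ((m : ℝ) + 2) else y j - 1 / ((m : ℝ) + 2)
    have hτ : ∀ m, Measurable (τ m) := fun m =>
      Measurable.ite (measurableSet_le (measurable_pi_apply j) measurable_const)
        (by fun_prop) (by fun_prop)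
    have hup : ∀ m, Measurable fun y : Fin s → ℝ => Function.update y j (τ m y) := fun m => by
      refine measurable_pi_iff.2 fun i => ?_
      by_cases h : i = j
      · subst h; simpa using hτ m
      · simpa [h] using measurable_pi_apply i
    refine stronglyMeasurable_of_tendsto Filter.atTop (f := fun (m : ℕ) =>
      (cube s).indicator fun y => (τ m y - y j)⁻¹ •
        ((cube s).indicator (D u) (Function.update y j (τ m y)) - (cube s).indicator (D u) y))
      (fun m => ?_) ?_
    · refine StronglyMeasurable.indicator ?_ (measurableSet_cube s)
      refine StronglyMeasurable.smul ?_ ((ih.comp_measurable (hup m)).sub ih)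
      exact (((hτ m).sub (measurable_pi_apply j)).inv).stronglyMeasurable
    · refine tendsto_pi_nhds.2 fun y => ?_
      by_cases hy : y ∈ cube s
      · simp only [Set.indicator_of_mem hy]
        have hyj := mem_cube.1 hy j
        have hpos : ∀ m : ℕ, (0 : ℝ) < 1 / ((m : ℝ) + 2) := fun m => by positivity
        have hsmall : ∀ m : ℕ, (1 : ℝ) / ((m : ℝ) + 2) ≤ 1 / 2 := fun m => by
          gcongr
          linarith [(Nat.cast_nonneg m : (0 : ℝ) ≤ m)]
        have hmem : ∀ m, τ m y ∈ Set.Icc (-(1 / 2) : ℝ) (1 / 2) := fun m => by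
          have h1 := hpos m
          have h2 := hsmall m
          simp only [τ]
          split_ifs <;> constructor <;> linarith [hyj.1, hyj.2]
        have hne : ∀ m, τ m y ≠ y j := fun m => by
          have h1 := hpos m
          simp only [τ]
          split_ifs <;> intro h <;> linarith
        have hlim : Filter.Tendsto (fun m => τ m y) Filter.atTop (nhds (y j)) := by
          have h0 : Filter.Tendsto (fun m : ℕ => (1 : ℝ) / ((m : ℝ) + 2)) Filter.atTop
              (nhds 0) := by
            have := (tendsto_one_div_add_atTop_nhds_zero_nat (𝕜 := ℝ)).comp
              (Filter.tendsto_add_atTop_nat 1)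
            refine this.congr fun m => ?_
            simp only [Function.comp, Nat.cast_add, Nat.cast_one]
            ring_nf
          by_cases h : y j ≤ 0
          · simpa [τ, h] using h0.const_add (y j)
          · simpa [τ, h] using h0.const_sub (y j)
        have hder := hasDerivWithinAt_iff_tendsto_slope.1 (hD.2 u j hj y hy)
        have hτlim : Filter.Tendsto (fun m => τ m y) Filter.atTop
            (nhdsWithin (y j) (Set.Icc (-(1 / 2)) (1 / 2) \ {y j})) :=
          tendsto_nhdsWithin_iff.2 ⟨hlim, Filter.Eventually.of_forall fun m => ⟨hmem m, hne m⟩⟩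
        refine (hder.comp hτlim).congr fun m => ?_
        simp only [Function.comp, slope, vsub_eq_sub, Function.update_eq_self]
        rw [Set.indicator_of_mem (update_mem_cube hy j (hmem m))]
      · simp [Set.indicator_of_notMem hy]

/-- The one-dimensional formula, applied coordinate by coordinate: the value at `y` is recovered
from the means of the mixed derivatives against products of Peano kernels. -/
theorem eq_sum_integral_peanoKernel [CompleteSpace Z] [TopologicalSpace.SeparableSpace Z]
    (hg : ContinuousOn g (cube s)) (hD : HasMixedDerivs g D) {B : Finset (Fin s) → ℝ}
    (hB : ∀ u, ∀ y ∈ cube s, ‖D u y‖ ≤ B u) {y : Fin s → ℝ} (hy : y ∈ cube s)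
    (A : Finset (Fin s)) :
    g y = ∑ u ∈ A.powerset, ∫ t, (∏ j ∈ u, peanoKernel (y j) (t j)) •
      (cube s).indicator (D u) (A.piecewise t y) ∂cubeUnif s := by
  have hE := stronglyMeasurable_indicator_deriv hg hD
  induction A using Finset.induction_on with
  | empty => simp [Set.indicator_of_mem hy, hD.1 y hy]
  | insert a A ha ih =>
    rw [ih, Finset.sum_powerset_insert ha, ← Finset.sum_add_distrib]
    refine Finset.sum_congr rfl fun u hu => ?_
    have hau : a ∉ u := fun h => ha (Finset.mem_powerset.1 hu h)
    -- The term of `u` for `A` splits into the terms `F u` and `F (insert a u)` for `insert a A`;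
    -- the integral over the new coordinate is absorbed by resampling `t a`.
    let F : Finset (Fin s) → (Fin s → ℝ) → Z := fun v t =>
      (∏ j ∈ v, peanoKernel (y j) (t j)) •
        (cube s).indicator (D v) ((insert a A).piecewise t y)
    have hFm : ∀ v, StronglyMeasurable (F v) := fun v => by
      refine StronglyMeasurable.smul (Measurable.stronglyMeasurable ?_)
        ((hE v).comp_measurable ?_)
      · exact Finset.measurable_prod _ fun j _ => measurable_peanoKernel.comp
          (measurable_const.prodMk (measurable_pi_apply j))
      · refine measurable_pi_iff.2 fun i => ?_
        by_cases h : i ∈ insert a A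
        · simpa only [Finset.piecewise_eq_of_mem _ _ _ h] using measurable_pi_apply i
        · simpa only [Finset.piecewise_eq_of_notMem _ _ _ h] using measurable_const
    have hFi : ∀ v, Integrable (F v) (cubeUnif s) := fun v => by
      refine Integrable.of_bound (hFm v).aestronglyMeasurable (B v) ?_
      filter_upwards [ae_cubeUnif_mem s] with t ht
      have h1 : ‖∏ j ∈ v, peanoKernel (y j) (t j)‖ ≤ 1 := by
        rw [norm_prod]
        exact Finset.prod_le_one (fun _ _ => norm_nonneg _)
          fun j _ => abs_peanoKernel_le (mem_cube.1 ht j)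
      have hp := piecewise_mem_cube ht hy (insert a A)
      simp only [F, norm_smul, Set.indicator_of_mem hp]
      exact (mul_le_of_le_one_left (norm_nonneg _) h1).trans (hB v _ hp)
    have hmp := measurePreserving_update (fun _ : Fin s => unif) a
    have hFub : ∀ v, ∫ t, F v t ∂cubeUnif s =
        ∫ t, ∫ τ, F v (Function.update t a τ) ∂unif ∂cubeUnif s := fun v => by
      have hint := (hmp.integrable_comp (hFm v).aestronglyMeasurable).2 (hFi v)
      have h := integral_prod _ hint
      simp only [Function.comp_apply] at h
      rw [cubeUnif, ← h, ← integral_map hmp.measurable.aemeasurable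
        (hFm v).aestronglyMeasurable, hmp.map_eq]
    have hFint : ∀ v, Integrable (fun t => ∫ τ, F v (Function.update t a τ) ∂unif)
        (cubeUnif s) := fun v =>
      ((hmp.integrable_comp (hFm v).aestronglyMeasurable).2 (hFi v)).integral_prod_left
    have hstep : ∀ᵐ t ∂cubeUnif s, (∏ j ∈ u, peanoKernel (y j) (t j)) •
        (cube s).indicator (D u) (A.piecewise t y) =
        (∫ τ, F u (Function.update t a τ) ∂unif) +
          ∫ τ, F (insert a u) (Function.update t a τ) ∂unif := by
      filter_upwards [ae_cubeUnif_mem s] with t ht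
      set x := A.piecewise t y with hx
      have hxc : x ∈ cube s := piecewise_mem_cube ht hy A
      have hxa : x a = y a := Finset.piecewise_eq_of_notMem _ _ _ ha
      have hpw : ∀ τ, (insert a A).piecewise (Function.update t a τ) y = Function.update x a τ :=
        fun τ => by
        rw [Finset.piecewise_insert, Function.update_self, hx]
        ext i
        by_cases hi : i = a
        · subst hi; simp
        · by_cases hiA : i ∈ A <;> simp [hi, hiA]
      have hprod : ∀ τ, ∏ j ∈ u, peanoKernel (y j) (Function.update t a τ j) =
          ∏ j ∈ u, peanoKernel (y j) (t j) := fun τ =>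
        Finset.prod_congr rfl fun j hj => by
          rw [Function.update_of_ne (ne_of_mem_of_not_mem hj hau)]
      have hF1 : ∀ τ, F u (Function.update t a τ) = (∏ j ∈ u, peanoKernel (y j) (t j)) •
          (cube s).indicator (D u) (Function.update x a τ) := fun τ => by
        simp only [F, hpw, hprod]
      have hF2 : ∀ τ, F (insert a u) (Function.update t a τ) =
          (∏ j ∈ u, peanoKernel (y j) (t j)) • peanoKernel (y a) τ •
          (cube s).indicator (D (insert a u)) (Function.update x a τ) := fun τ => by
        simp only [F, hpw, Finset.prod_insert hau, hprod, Function.update_self, smul_smul]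
        rw [mul_comm]
      simp_rw [hF1, hF2]
      rw [integral_smul, integral_smul, ← smul_add, Set.indicator_of_mem hxc]
      congr 1
      have hind : ∀ v, ∀ᵐ τ ∂unif, (cube s).indicator (D v) (Function.update x a τ) =
          D v (Function.update x a τ) := fun v => by
        filter_upwards [ae_unif_mem] with τ hτ
        exact Set.indicator_of_mem (update_mem_cube hxc a hτ) _
      rw [integral_congr_ae (hind u), integral_congr_ae
        (f := fun τ => peanoKernel (y a) τ •
          (cube s).indicator (D (insert a u)) (Function.update x a τ))
        (g := fun τ => peanoKernel (y a) τ • D (insert a u) (Function.update x a τ))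
        (by filter_upwards [hind (insert a u)] with τ hτ; rw [hτ])]
      have h1 := eq_integral_add_integral_peanoKernel
        (f := fun τ => D u (Function.update x a τ))
        (f' := fun τ => D (insert a u) (Function.update x a τ)) (fun τ hτ => ?_) ?_
        (mem_cube.1 hy a)
      · rw [← hxa, Function.update_eq_self] at h1
        rw [← hxa]
        exact h1
      · simpa using hD.2 u a hau (Function.update x a τ) (update_mem_cube hxc a hτ)
      · have hm : StronglyMeasurable fun τ =>
            (cube s).indicator (D (insert a u)) (Function.update x a τ) :=
          (hE _).comp_measurable (measurable_update x)
        refine Integrable.of_bound (hm.aestronglyMeasurable.congr (hind _)) (B (insert a u)) ?_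
        filter_upwards [ae_unif_mem] with τ hτ
        exact hB _ _ (update_mem_cube hxc a hτ)
    rw [integral_congr_ae hstep, integral_add (hFint u) (hFint (insert a u)), ← hFub, ← hFub]

end Representation

/-! ### The error of the shifted lattice rule -/

theorem norm_integral_smul_sq_le {α Z : Type*} [MeasurableSpace α] [NormedAddCommGroup Z]
    [NormedSpace ℝ Z] {μ : Measure α} [IsProbabilityMeasure μ] {h : α → ℝ} {f : α → Z} {B : ℝ}
    (hh : MemLp h 2 μ) (hf : ∀ᵐ x ∂μ, ‖f x‖ ≤ B) :
    ‖∫ x, h x • f x ∂μ‖ ^ 2 ≤ B ^ 2 * ∫ x, h x ^ 2 ∂μ := by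
  have hi : Integrable (fun x => |h x|) μ := (hh.integrable one_le_two).abs
  have hi2 : Integrable (fun x => h x ^ 2) μ := hh.integrable_sq
  have h1 : ‖∫ x, h x • f x ∂μ‖ ≤ (∫ x, |h x| ∂μ) * B := by
    rw [← integral_mul_const]
    refine norm_integral_le_of_norm_le (hi.mul_const B) ?_
    filter_upwards [hf] with x hx
    rw [norm_smul, Real.norm_eq_abs]
    gcongr
  set c := ∫ x, |h x| ∂μ with hc
  -- Expanding `0 ≤ ∫ (|h| - c) ^ 2`.
  have h2 : c ^ 2 ≤ ∫ x, h x ^ 2 ∂μ := by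
    have h0 : 0 ≤ ∫ x, (|h x| - c) ^ 2 ∂μ := integral_nonneg fun x => sq_nonneg _
    have e : ∀ x, (|h x| - c) ^ 2 = h x ^ 2 - 2 * c * |h x| + c ^ 2 := fun x => by
      rw [sub_sq, sq_abs]; ring
    simp_rw [e] at h0
    have hi3 : Integrable (fun x => h x ^ 2 - 2 * c * |h x|) μ := hi2.sub (hi.const_mul _)
    rw [integral_add hi3 (integrable_const _),
      integral_sub hi2 (hi.const_mul _), integral_const_mul, ← hc, integral_const] at h0
    simp only [probReal_univ, one_smul] at h0
    nlinarith
  calc ‖∫ x, h x • f x ∂μ‖ ^ 2 ≤ (c * B) ^ 2 := by gcongr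
    _ = B ^ 2 * c ^ 2 := by ring
    _ ≤ _ := by gcongr

theorem integral_finset_prod_pi {ι : Type*} [Fintype ι] (μ : ι → Measure ℝ)
    [∀ i, IsProbabilityMeasure (μ i)] (u : Finset ι) (f : ι → ℝ → ℝ) :
    ∫ t, ∏ j ∈ u, f j (t j) ∂Measure.pi μ = ∏ j ∈ u, ∫ x, f j x ∂μ j := by
  classical
  have h := integral_fintype_prod_eq_prod (𝕜 := ℝ) (μ := μ)
    (fun j x => if j ∈ u then f j x else 1)
  have e : ∀ j, ∫ x, (if j ∈ u then f j x else 1) ∂μ j =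
      if j ∈ u then ∫ x, f j x ∂μ j else 1 := fun j => by
    split_ifs <;> simp
  simp_rw [e] at h
  simpa [Finset.prod_ite_mem] using h

/-- The kernel by which the shifted lattice rule acts on the mixed derivative `∂^{|u|} / ∂y_u`. -/
noncomputable def latticeKernel {s : ℕ} (n : ℕ) (z : Fin s → ℕ) (Δ : Fin s → ℝ)
    (u : Finset (Fin s)) (t : Fin s → ℝ) : ℝ :=
  1 / (n : ℝ) * ∑ i ∈ Finset.Icc 1 n, ∏ j ∈ u, peanoKernel (latticePoint n z Δ i j) (t j)

theorem latticePoint_mem_cube {s : ℕ} (n : ℕ) (z : Fin s → ℕ) (Δ : Fin s → ℝ) (i : ℕ) :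
    latticePoint n z Δ i ∈ cube s := by
  refine mem_cube.2 fun j => ?_
  have h0 := Int.fract_nonneg ((i : ℝ) * (z j : ℝ) / (n : ℝ) + Δ j)
  have h1 := Int.fract_lt_one ((i : ℝ) * (z j : ℝ) / (n : ℝ) + Δ j)
  constructor <;> simp only [latticePoint] <;> linarith

theorem measurable_latticePoint {s : ℕ} (n : ℕ) (z : Fin s → ℕ) (i : ℕ) :
    Measurable fun Δ : Fin s → ℝ => latticePoint n z Δ i := by
  refine measurable_pi_iff.2 fun j => ?_
  unfold latticePoint
  fun_prop

theorem memLp_prod_peanoKernel {s : ℕ} (u : Finset (Fin s)) (y : Fin s → ℝ) (p : ENNReal) :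
    MemLp (fun t : Fin s → ℝ => ∏ j ∈ u, peanoKernel (y j) (t j)) p (cubeUnif s) := by
  refine MemLp.of_bound (Measurable.aestronglyMeasurable ?_) 1 ?_
  · exact Finset.measurable_prod _ fun j _ => measurable_peanoKernel.comp
      (measurable_const.prodMk (measurable_pi_apply j))
  · filter_upwards [ae_cubeUnif_mem s] with t ht
    rw [norm_prod]
    exact Finset.prod_le_one (fun _ _ => norm_nonneg _)
      fun j _ => abs_peanoKernel_le (mem_cube.1 ht j)

theorem memLp_latticeKernel {s : ℕ} (n : ℕ) (z : Fin s → ℕ) (Δ : Fin s → ℝ)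
    (u : Finset (Fin s)) (p : ENNReal) : MemLp (latticeKernel n z Δ u) p (cubeUnif s) :=
  (memLp_finsetSum _ fun i _ => memLp_prod_peanoKernel u (latticePoint n z Δ i) p).const_mul _

section Error

variable {s : ℕ} {Z : Type*} [NormedAddCommGroup Z] [NormedSpace ℝ Z]
  {g : (Fin s → ℝ) → Z} {D : Finset (Fin s) → (Fin s → ℝ) → Z}

/-- The term of `u = ∅` in the representation is the integral, so it drops out of the error. -/
theorem latticeRule_sub_integral [CompleteSpace Z] [TopologicalSpace.SeparableSpace Z]
    (hg : ContinuousOn g (cube s)) (hD : HasMixedDerivs g D) {B : Finset (Fin s) → ℝ}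
    (hB : ∀ u, ∀ y ∈ cube s, ‖D u y‖ ≤ B u) {n : ℕ} (hn : 1 ≤ n) (z : Fin s → ℕ)
    (Δ : Fin s → ℝ) :
    latticeRule n z Δ g - ∫ y in cube s, g y =
      ∑ u : Finset (Fin s) with u.Nonempty,
        ∫ t, latticeKernel n z Δ u t • (cube s).indicator (D u) t ∂cubeUnif s := by
  have hE := stronglyMeasurable_indicator_deriv hg hD
  have hint : ∀ i u, Integrable (fun t => (∏ j ∈ u, peanoKernel (latticePoint n z Δ i j) (t j)) •
      (cube s).indicator (D u) t) (cubeUnif s) := fun i u => by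
    refine ((memLp_prod_peanoKernel u (latticePoint n z Δ i) 1).integrable le_rfl).smul_bdd (B u)
      (hE u).aestronglyMeasurable ?_
    filter_upwards [ae_cubeUnif_mem s] with t ht
    rw [Set.indicator_of_mem ht]
    exact hB u t ht
  have hrep : ∀ i, g (latticePoint n z Δ i) =
      ∑ u : Finset (Fin s), ∫ t, (∏ j ∈ u, peanoKernel (latticePoint n z Δ i j) (t j)) •
        (cube s).indicator (D u) t ∂cubeUnif s := fun i => by
    simpa using eq_sum_integral_peanoKernel hg hD hB (latticePoint_mem_cube n z Δ i) Finset.univ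
  have hsum : latticeRule n z Δ g = ∑ u : Finset (Fin s),
      ∫ t, latticeKernel n z Δ u t • (cube s).indicator (D u) t ∂cubeUnif s := by
    unfold latticeRule
    simp_rw [hrep]
    rw [Finset.sum_comm, Finset.smul_sum]
    refine Finset.sum_congr rfl fun u _ => ?_
    rw [← integral_finsetSum _ fun i _ => hint i u, ← integral_smul]
    refine integral_congr_ae (Filter.Eventually.of_forall fun t => ?_)
    simp only [latticeKernel, ← Finset.sum_smul, smul_smul]
  have hempty : ∫ t, latticeKernel n z Δ ∅ t • (cube s).indicator (D ∅) t ∂cubeUnif s =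
      ∫ y in cube s, g y := by
    rw [restrict_cube]
    refine integral_congr_ae ?_
    filter_upwards [ae_cubeUnif_mem s] with t ht
    have hn' : (n : ℝ) ≠ 0 := by positivity
    simp [latticeKernel, Set.indicator_of_mem ht, hD.1 t ht, hn']
  have hfilter : (Finset.univ.filter fun u : Finset (Fin s) => u.Nonempty) =
      Finset.univ.erase ∅ := by
    ext u
    simp [Finset.nonempty_iff_ne_empty]
  rw [hsum, ← hempty, hfilter, ← Finset.add_sum_erase _ _ (Finset.mem_univ ∅),
    add_sub_cancel_left]

/-- The error in terms of the shift alone: Cauchy–Schwarz separates the bounds for the integrand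
from the kernels of the rule. -/
theorem sqError_le [CompleteSpace Z] [TopologicalSpace.SeparableSpace Z]
    (hg : ContinuousOn g (cube s)) (hD : HasMixedDerivs g D) {B : Finset (Fin s) → ℝ}
    (hB : ∀ u, ∀ y ∈ cube s, ‖D u y‖ ≤ B u) {γ : Finset (Fin s) → ℝ} (hγ : ∀ u, 0 < γ u)
    {n : ℕ} (hn : 1 ≤ n) (z : Fin s → ℕ) (Δ : Fin s → ℝ) :
    sqError n z g Δ ≤ (∑ u, B u ^ 2 / γ u) * ∑ u : Finset (Fin s) with u.Nonempty,
      γ u * ∫ t, latticeKernel n z Δ u t ^ 2 ∂cubeUnif s := by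
  have hI : ∀ u, 0 ≤ ∫ t, latticeKernel n z Δ u t ^ 2 ∂cubeUnif s := fun u =>
    integral_nonneg fun t => sq_nonneg _
  rw [sqError, norm_sub_rev, latticeRule_sub_integral hg hD hB hn]
  refine (pow_le_pow_left₀ (norm_nonneg _) (norm_sum_le _ _) 2).trans ?_
  refine (Finset.sum_sq_le_sum_mul_sum_of_sq_le_mul _ (f := fun u => B u ^ 2 / γ u)
    (g := fun u => γ u * ∫ t, latticeKernel n z Δ u t ^ 2 ∂cubeUnif s)
    (fun u _ => div_nonneg (sq_nonneg _) (hγ u).le) (fun u _ => mul_nonneg (hγ u).le (hI u))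
    fun u _ => ?_).trans ?_
  · have hne := (hγ u).ne'
    have h := norm_integral_smul_sq_le (f := (cube s).indicator (D u)) (B := B u)
      (memLp_latticeKernel n z Δ u 2) (by
        filter_upwards [ae_cubeUnif_mem s] with t ht
        rw [Set.indicator_of_mem ht]
        exact hB u t ht)
    refine h.trans_eq ?_
    field_simp
  · refine mul_le_mul_of_nonneg_right ?_
      (Finset.sum_nonneg fun u _ => mul_nonneg (hγ u).le (hI u))
    exact Finset.sum_le_sum_of_subset_of_nonneg (Finset.subset_univ _)
      fun u _ _ => div_nonneg (sq_nonneg _) (hγ u).le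

end Error

/-! ### Averaging over the shift -/

theorem restrict_Icc_zero_one (s : ℕ) :
    volume.restrict (Set.Icc (0 : Fin s → ℝ) 1) =
      Measure.pi fun _ => volume.restrict (Set.Icc (0 : ℝ) 1) := by
  rw [← Set.pi_univ_Icc, volume_pi, Measure.restrict_pi_pi]
  rfl

instance : IsProbabilityMeasure (volume.restrict (Set.Icc (0 : ℝ) 1)) :=
  ⟨by rw [Measure.restrict_apply_univ, Real.volume_Icc]; norm_num⟩

/-- Expanding the square, the integral over the cube factors into one-dimensional integrals. -/
theorem integral_latticeKernel_sq {s : ℕ} (n : ℕ) (z : Fin s → ℕ) (Δ : Fin s → ℝ)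
    (u : Finset (Fin s)) :
    ∫ t, latticeKernel n z Δ u t ^ 2 ∂cubeUnif s =
      (1 / (n : ℝ)) ^ 2 * ∑ i ∈ Finset.Icc 1 n, ∑ i' ∈ Finset.Icc 1 n, ∏ j ∈ u,
        peanoGram (Int.fract ((i : ℝ) * (z j : ℝ) / (n : ℝ) + Δ j))
          (Int.fract ((i' : ℝ) * (z j : ℝ) / (n : ℝ) + Δ j)) := by
  have hint : ∀ i i' : ℕ, Integrable (fun t : Fin s → ℝ =>
      (∏ j ∈ u, peanoKernel (latticePoint n z Δ i j) (t j)) *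
        ∏ j ∈ u, peanoKernel (latticePoint n z Δ i' j) (t j)) (cubeUnif s) := fun i i' =>
    (memLp_prod_peanoKernel u _ 2).integrable_mul (memLp_prod_peanoKernel u _ 2)
  simp only [latticeKernel, mul_pow, pow_two (Finset.sum _ _), Finset.sum_mul_sum]
  rw [integral_const_mul, integral_finsetSum _ fun i _ => integrable_finsetSum _ fun i' _ =>
    hint i i']
  congr 1
  refine Finset.sum_congr rfl fun i _ => ?_
  rw [integral_finsetSum _ fun i' _ => hint i i']
  refine Finset.sum_congr rfl fun i' _ => ?_
  simp_rw [← Finset.prod_mul_distrib]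
  rw [cubeUnif, integral_finset_prod_pi (fun _ => unif) u fun j t =>
    peanoKernel (latticePoint n z Δ i j) t * peanoKernel (latticePoint n z Δ i' j) t]
  refine Finset.prod_congr rfl fun j _ => ?_
  exact integral_peanoKernel_mul ⟨Int.fract_nonneg _, (Int.fract_lt_one _).le⟩
    ⟨Int.fract_nonneg _, (Int.fract_lt_one _).le⟩

theorem integrable_prod_peanoGram {s : ℕ} (u : Finset (Fin s)) (a b : Fin s → ℝ) :
    IntegrableOn (fun Δ : Fin s → ℝ =>
      ∏ j ∈ u, peanoGram (Int.fract (a j + Δ j)) (Int.fract (b j + Δ j))) (Set.Icc 0 1) := by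
  rw [IntegrableOn, restrict_Icc_zero_one]
  refine Integrable.of_bound (Measurable.aestronglyMeasurable ?_) (∏ j ∈ u, 2)
    (Filter.Eventually.of_forall fun Δ => ?_)
  · exact Finset.measurable_prod _ fun j _ =>
      (measurable_peanoGram_fract (a j) (b j)).comp (measurable_pi_apply j)
  · rw [norm_prod]
    exact Finset.prod_le_prod (fun _ _ => norm_nonneg _) fun j _ => abs_peanoGram_le
      ⟨Int.fract_nonneg _, (Int.fract_lt_one _).le⟩ ⟨Int.fract_nonneg _, (Int.fract_lt_one _).le⟩

theorem integrableOn_integral_latticeKernel_sq {s : ℕ} (n : ℕ) (z : Fin s → ℕ)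
    (u : Finset (Fin s)) :
    IntegrableOn (fun Δ => ∫ t, latticeKernel n z Δ u t ^ 2 ∂cubeUnif s) (Set.Icc 0 1) := by
  simp_rw [integral_latticeKernel_sq]
  exact (integrable_finsetSum _ fun i _ => integrable_finsetSum _ fun i' _ =>
    integrable_prod_peanoGram u _ _).const_mul _

theorem sum_range_add_of_periodic {f : ℤ → ℝ} {n : ℕ} (hf : ∀ m, f (m + n) = f m) (a : ℤ) :
    ∑ k ∈ Finset.range n, f (k + a) = ∑ k ∈ Finset.range n, f k := by
  have hstep : ∀ a : ℤ, ∑ k ∈ Finset.range n, f (k + (a + 1)) =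
      ∑ k ∈ Finset.range n, f (k + a) := fun a => by
    have h1 := Finset.sum_range_succ (fun k : ℕ => f (k + a)) n
    have h2 := Finset.sum_range_succ' (fun k : ℕ => f (k + a)) n
    have h3 : f ((n : ℤ) + a) = f (((0 : ℕ) : ℤ) + a) := by
      rw [add_comm, hf]; simp
    rw [h1, h3] at h2
    have h4 := add_right_cancel h2
    rw [h4]
    refine Finset.sum_congr rfl fun k _ => ?_
    congr 1
    push_cast
    ring
  induction a using Int.induction_on with
  | zero => simp
  | succ a ih => rw [hstep, ih]
  | pred a ih => rw [← ih, ← hstep (-(a : ℤ) - 1), sub_add_cancel]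

/-- The shift average of the squared kernel is the quantity minimized by the component-by-component
construction. -/
theorem integral_integral_latticeKernel_sq {s n : ℕ} (hn : 1 ≤ n) (z : Fin s → ℕ)
    (u : Finset (Fin s)) :
    ∫ Δ in Set.Icc (0 : Fin s → ℝ) 1, ∫ t, latticeKernel n z Δ u t ^ 2 ∂cubeUnif s =
      latticeMean n z u := by
  have hn' : (n : ℝ) ≠ 0 := by positivity
  simp_rw [integral_latticeKernel_sq]
  rw [integral_const_mul, integral_finsetSum _ fun i _ => integrable_finsetSum _ fun i' _ =>
    integrable_prod_peanoGram u _ _]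
  let f : ℤ → ℝ := fun m => ∏ j ∈ u, bernoulliFun 2 (Int.fract ((m : ℝ) * (z j : ℝ) / (n : ℝ)))
  have hf : ∀ m, f (m + n) = f m := fun m => Finset.prod_congr rfl fun j _ => by
    have : (((m + n : ℤ) : ℝ) * (z j : ℝ) / (n : ℝ)) = (m : ℝ) * (z j : ℝ) / n + (z j : ℕ) := by
      push_cast
      field_simp
    rw [this, Int.fract_add_natCast]
  have hterm : ∀ i i' : ℕ, ∫ Δ in Set.Icc (0 : Fin s → ℝ) 1, ∏ j ∈ u,
      peanoGram (Int.fract ((i : ℝ) * (z j : ℝ) / (n : ℝ) + Δ j))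
          (Int.fract ((i' : ℝ) * (z j : ℝ) / (n : ℝ) + Δ j)) = f (i - i') := fun i i' => by
    rw [restrict_Icc_zero_one, integral_finset_prod_pi _ u fun j δ =>
      peanoGram (Int.fract ((i : ℝ) * (z j : ℝ) / (n : ℝ) + δ))
          (Int.fract ((i' : ℝ) * (z j : ℝ) / (n : ℝ) + δ))]
    refine Finset.prod_congr rfl fun j _ => ?_
    rw [integral_peanoGram_fract]
    push_cast
    ring_nf
  -- For each `i'` the differences `i - i'` run through a full period.
  have hinner : ∀ i' : ℕ, ∑ i ∈ Finset.Icc 1 n, f (i - i') = ∑ k ∈ Finset.range n, f k := by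
    intro i'
    rw [← sum_range_add_of_periodic hf (1 - i'), ← Finset.Ico_add_one_right_eq_Icc,
      Finset.sum_Ico_eq_sum_range]
    refine Finset.sum_congr (by simp) fun k _ => ?_
    congr 1
    push_cast
    ring
  have hswap : ∀ i ∈ Finset.Icc 1 n, ∫ Δ in Set.Icc (0 : Fin s → ℝ) 1,
      ∑ i' ∈ Finset.Icc 1 n, ∏ j ∈ u,
        peanoGram (Int.fract ((i : ℝ) * (z j : ℝ) / (n : ℝ) + Δ j))
          (Int.fract ((i' : ℝ) * (z j : ℝ) / (n : ℝ) + Δ j)) =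
      ∑ i' ∈ Finset.Icc 1 n, f (i - i') := fun i _ => by
    rw [integral_finsetSum _ fun i' _ => integrable_prod_peanoGram u _ _]
    exact Finset.sum_congr rfl fun i' _ => hterm i i'
  rw [Finset.sum_congr rfl hswap, Finset.sum_comm]
  simp_rw [hinner]
  rw [Finset.sum_const, Nat.card_Icc, Nat.add_sub_cancel, nsmul_eq_mul, latticeMean]
  simp only [f, Int.cast_natCast]
  field_simp

/-! ### The error bound -/

theorem integrableOn_sqError {s : ℕ} {Z : Type*} [NormedAddCommGroup Z] [NormedSpace ℝ Z]
    [TopologicalSpace.SeparableSpace Z] {g : (Fin s → ℝ) → Z} (hg : ContinuousOn g (cube s))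
    {D : Finset (Fin s) → (Fin s → ℝ) → Z} (hD : HasMixedDerivs g D) (n : ℕ) (z : Fin s → ℕ)
    {W : (Fin s → ℝ) → ℝ} (hW : IntegrableOn W (Set.Icc 0 1)) (hle : ∀ Δ, sqError n z g Δ ≤ W Δ) :
    IntegrableOn (sqError n z g) (Set.Icc 0 1) := by
  refine Integrable.mono' hW (StronglyMeasurable.aestronglyMeasurable ?_)
    (Filter.Eventually.of_forall fun Δ => ?_)
  · have hpt : ∀ i, StronglyMeasurable fun Δ => g (latticePoint n z Δ i) := fun i => by
      have h := (stronglyMeasurable_indicator_deriv hg hD ∅).comp_measurable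
        (measurable_latticePoint n z i)
      have e : (cube s).indicator (D ∅) ∘ (fun Δ => latticePoint n z Δ i) =
          fun Δ => g (latticePoint n z Δ i) := funext fun Δ => by
        rw [Function.comp_apply, Set.indicator_of_mem (latticePoint_mem_cube n z Δ i),
          hD.1 _ (latticePoint_mem_cube n z Δ i)]
      rwa [e] at h
    have hrule : StronglyMeasurable fun Δ => latticeRule n z Δ g :=
      (Finset.stronglyMeasurable_fun_sum _ fun i _ => hpt i).const_smul _
    exact (stronglyMeasurable_const.sub hrule).norm.pow 2
  · exact (Real.norm_of_nonneg (sq_nonneg _)).trans_le (hle Δ)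

end RandomLattice

open RandomLattice in
theorem mainTheorem3 (s n : ℕ) (hn : 1 ≤ n)
    {Z : Type*} [NormedAddCommGroup Z] [NormedSpace ℝ Z] [CompleteSpace Z]
    [TopologicalSpace.SeparableSpace Z]
    (γ : Finset (Fin s) → ℝ) (hγ : ∀ u, 0 < γ u)
    (g : (Fin s → ℝ) → Z) (hg : ContinuousOn g (RandomLattice.cube s))
    (D : Finset (Fin s) → (Fin s → ℝ) → Z) (hD : RandomLattice.HasMixedDerivs g D)
    (C₀ r₁ r₂ : ℝ) (hC₀ : 0 < C₀) (hr₁ : 0 ≤ r₁) (hr₂ : 0 < r₂)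
    (ρ : Fin s → ℝ) (hρ : ∀ j, 0 < ρ j)
    (hbound : ∀ u : Finset (Fin s), ∀ y ∈ RandomLattice.cube s,
      ‖D u y‖ ≤ C₀ * RandomLattice.realFactorial (u.card + r₁) * ∏ j ∈ u, (r₂ * ρ j)) :
    IntegrableOn g (RandomLattice.cube s) ∧
    (∃ z : Fin s → ℕ, RandomLattice.IsCBC n γ z) ∧
    (∀ z : Fin s → ℕ, RandomLattice.IsCBC n γ z →
      IntegrableOn (RandomLattice.sqError n z g) (Set.Icc 0 1) ∧
      ∀ lam : ℝ, 1 / 2 < lam → lam ≤ 1 →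
        ∫ Δ in Set.Icc (0 : Fin s → ℝ) 1, RandomLattice.sqError n z g Δ ≤
          RandomLattice.errorConst γ C₀ r₁ r₂ ρ lam * (Nat.totient n : ℝ) ^ (-(1 / lam))) ∧
    (IsPrimePow n → 1 / (Nat.totient n : ℝ) ≤ 2 / (n : ℝ)) := by
  have : NeZero n := ⟨by omega⟩
  refine ⟨hg.integrableOn_compact isCompact_Icc, exists_isCBC hn γ, fun z hz => ?_,
    one_div_totient_le_of_isPrimePow⟩
  -- The bound for the squared norm of `g` in the weighted Sobolev space.
  set M := ∑ u : Finset (Fin s),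
    (C₀ * realFactorial (u.card + r₁) * ∏ j ∈ u, (r₂ * ρ j)) ^ 2 / γ u with hM
  have hM0 : 0 ≤ M := Finset.sum_nonneg fun u _ => div_nonneg (sq_nonneg _) (hγ u).le
  have hMeq : M = C₀ ^ 2 * ∑ u : Finset (Fin s),
      realFactorial (u.card + r₁) ^ 2 * (∏ j ∈ u, (r₂ * ρ j) ^ 2) / γ u := by
    rw [hM, Finset.mul_sum]
    refine Finset.sum_congr rfl fun u _ => ?_
    rw [Finset.prod_pow]
    ring
  have hle := sqError_le hg hD hbound hγ hn z
  have hWi : ∀ u ∈ Finset.univ.filter fun u : Finset (Fin s) => u.Nonempty,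
      IntegrableOn (fun Δ => γ u * ∫ t, latticeKernel n z Δ u t ^ 2 ∂cubeUnif s)
        (Set.Icc 0 1) := fun u _ =>
    (integrableOn_integral_latticeKernel_sq n z u).const_mul _
  have hW := (integrable_finsetSum _ hWi).const_mul M
  have hint := integrableOn_sqError hg hD n z hW hle
  refine ⟨hint, fun lam hlam hlam1 => ?_⟩
  calc ∫ Δ in Set.Icc (0 : Fin s → ℝ) 1, sqError n z g Δ
      ≤ M * ∑ u : Finset (Fin s) with u.Nonempty, γ u * latticeMean n z u := by
        refine (integral_mono hint hW hle).trans_eq ?_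
        rw [integral_const_mul, integral_finsetSum _ hWi]
        simp_rw [integral_const_mul, integral_integral_latticeKernel_sq hn]
    _ ≤ M * ((∑ u : Finset (Fin s) with u.Nonempty, γ u ^ lam *
        (2 * (riemannZeta ((2 * lam : ℝ) : ℂ)).re / (2 * Real.pi ^ 2) ^ lam) ^ u.card) ^ (1 / lam) *
        (n.totient : ℝ) ^ (-(1 / lam))) :=
        mul_le_mul_of_nonneg_left (sum_latticeMean_le_of_isCBC hγ hz hlam hlam1) hM0
    _ = _ := by
        rw [hMeq, errorConst]
        ring
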